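/- **Theorem (smile asymptotics of Merton's model).** Let $\mu,\alpha\in\mathbb R$ and $\sigma,\lambda,\delta\in(0,\infty)$, and let $(X_t)_{t>0}$ be real random variables on a probability space (the log-price in Merton's jump-diffusion model) such that for every $t>0$ $$\mathbb E\big[e^{zX_t}\big]=\exp\Big(t\Big\{z\mu+\tfrac12 z^2\sigma^2+\lambda\big(e^{z\alpha+z^2\delta^2/2}-1\big)\Big\}\Big)\qquad\text{for all } z\in\mathbb C ,$$ and $\mathbb E[e^{X_t}]=1$ (risk-neutrality; this holds in particular if $(e^{X_t})_{t\ge0}$ is a martingale with $X_0=0$). For $\kappa\ge 0$ and $t>0$ let $c(\kappa,t)=\mathbb E[(e^{X_t}-e^{\kappa})^+]$. Then there is a unique $s\in[0,\infty)$ with $$\mathbb E\big[(e^{s\sqrt t\,Z-\frac12 s^2t}-e^{\kappa})^+\big]=c(\kappa,t),\qquad Z\sim N(0,1);$$ denote this $s$, the implied volatility, by $\sigma_{\rm imp}(\kappa,t)$. Set $\bar\kappa_1(t)=\sqrt{t\log\frac1t}$ and $\bar\kappa_2(t)=\sqrt{\log\frac1t}$ for $0<t<1$, and $f(a)=\min_{n\in\{1,2,3,\dots\}}\big(n+\frac{a^2}{2n\delta^2}\big)$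 for $a\ge0$. Consider an arbitrary family (sequence, curve, or net) of values of $(\kappa,t)$ with $\kappa\ge0$ and $t>0$. All limits are taken along the family, and $g\sim h$ means $g/h\to1$. 1. If $t\to0$ and $\kappa=O(\bar\kappa_2(t))$, then for every fixed $\theta>1$ $$\sigma_{\rm imp}(\kappa,t)\sim\max\left\{\sigma,\ \frac{\kappa}{\sqrt{2t\,f\big(\frac{\kappa}{\bar\kappa_2(t)}\big)\log\frac{\kappa}{t}}}\right\},$$ where the second term in the maximum is read as $0$ when $\kappa<\theta t$. More explicitly, as $t\to0$, $$\sigma_{\rm imp}(\kappa,t)\sim\begin{cases}\sigma & \text{if } 0\le\kappa\le\sigma\bar\kappa_1(t),\\[2pt] \dfrac{\kappa}{\sqrt{2t\log\frac{\kappa}{t}}} & \text{if } \sigma\bar\kappa_1(t)\le\kappa\ll\bar\kappa_2(t),\\[6pt] \dfrac{\kappa}{\sqrt{2t\,f(a)\log\frac{\kappa}{t}}} & \text{if } \kappa\sim a\,\bar\kappa_2(t)\text{ with } a\in(0,\infty).\end{cases}$$ 2. If $t\to0$ and $\kappa\gg\bar\kappa_2(t)$, or if $t\to\bar t\in(0,\infty)$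 and $\kappa\to\infty$, then $$\sigma_{\rm imp}(\kappa,t)\sim\sqrt{\frac{\delta\,\kappa}{2t\sqrt{2\log\frac{\kappa}{t}}}}\,.$$ -/

import Mathlib

open MeasureTheory ProbabilityTheory Filter Topology Asymptotics

/-- `(X t)` is the log-price in Merton's jump-diffusion model, under the risk-neutral measure `P`:
for every `t > 0` the moment generating function of `X t` is, for all complex `z`,
`exp (t {z μ + z² σ² / 2 + lam (exp (z α + z² δ² / 2) - 1)})`
(so that `X t` has the law of `σ W t + μ t + Y 1 + ... + Y (N t)` with `W` a Brownian motion,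
`N t` Poisson of mean `lam t`, and `Y i` Gaussian of mean `α` and variance `δ²`),
and the price `exp (X t)` has mean one. The latter is all of the martingale property of the price
process (with `X 0 = 0`) that concerns the one-dimensional marginals. -/
structure IsMertonModel {Ω : Type*} [MeasurableSpace Ω] (P : Measure Ω) (X : ℝ → Ω → ℝ)
    (μ α σ lam δ : ℝ) : Prop where
  sigma_pos : 0 < σ
  lam_pos : 0 < lam
  delta_pos : 0 < δ
  aemeasurable : ∀ t, 0 < t → AEMeasurable (X t) P
  mgf_eq : ∀ t : ℝ, 0 < t → ∀ z : ℂ,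
    complexMGF (X t) P z = Complex.exp ((t : ℂ) * (z * (μ : ℂ) + 1 / 2 * z ^ 2 * (σ : ℂ) ^ 2
      + (lam : ℂ) * (Complex.exp (z * (α : ℂ) + z ^ 2 * ((δ : ℂ) ^ 2 / 2)) - 1)))
  risk_neutral : ∀ t : ℝ, 0 < t → ∫ ω, Real.exp (X t ω) ∂P = 1

/-- Price `E[(exp (X t) - exp k)⁺]` of a European call with log-strike `k` and maturity `t`. -/
noncomputable def callPrice {Ω : Type*} [MeasurableSpace Ω] (P : Measure Ω) (X : ℝ → Ω → ℝ)
    (k t : ℝ) : ℝ :=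
  ∫ ω, max (Real.exp (X t ω) - Real.exp k) 0 ∂P

/-- Black-Scholes price `E[(exp (v Z - v² / 2) - exp k)⁺]` of a normalized European call, with
`Z` a standard Gaussian random variable. -/
noncomputable def bsCall (k v : ℝ) : ℝ :=
  ∫ z, max (Real.exp (v * z - v ^ 2 / 2) - Real.exp k) 0 ∂(gaussianReal 0 1)

/-- The volatility `s ∈ [0, ∞)`, plugged into the Black-Scholes formula for log-strike `k` and
maturity `t`, yields the call price of the model `X`. -/
def IsImpliedVol {Ω : Type*} [MeasurableSpace Ω] (P : Measure Ω) (X : ℝ → Ω → ℝ)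
    (k t s : ℝ) : Prop :=
  0 ≤ s ∧ bsCall k (s * √t) = callPrice P X k t

/-- The implied volatility: the number `s` with `IsImpliedVol P X k t s`. (The infimum of a set
with exactly one element is that element; existence and uniqueness are part of the theorem.) -/
noncomputable def impliedVol {Ω : Type*} [MeasurableSpace Ω] (P : Measure Ω) (X : ℝ → Ω → ℝ)
    (k t : ℝ) : ℝ :=
  sInf {s : ℝ | IsImpliedVol P X k t s}

/-- The scale `√(t log (1 / t))`. -/
noncomputable def kbar1 (t : ℝ) : ℝ := √(t * Real.log (1 / t))

/-- The scale `√(log (1 / t))`. -/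
noncomputable def kbar2 (t : ℝ) : ℝ := √(Real.log (1 / t))

/-- `f(a) = min over n = 1, 2, 3, ... of n + a² / (2 n δ²)`. -/
noncomputable def mertonF (δ a : ℝ) : ℝ :=
  ⨅ n : ℕ+, (((n : ℕ) : ℝ) + a ^ 2 / (2 * ((n : ℕ) : ℝ) * δ ^ 2))

/-! Conditioning on the number of Gaussian jumps turns the call price into a Poisson mixture of
lognormal call prices (`IsMertonModel.hasSum_callPrice`). On the Black-Scholes side, the derivative
in the total volatility `v` is a Gaussian density whose main factor is `exp (-k² / (2 v²))`. Hence a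
price of the form `κ exp (-q (1 + o(1)))`, with `q → ∞` and `κ / q → 0`, corresponds to `v ∼ κ / √(2
q)` (`eventually_bsCall_bracket`), and apart from the smallest strikes it remains to find `q`.

Put `ℓ = log (1 / t)` and `L = log (κ / t)`. Making `n ≥ 1` jumps that carry the log-price to `κ`
has probability about `exp (-n ℓ - κ² / (2 n δ²))` when `n` is bounded; making none costs `exp (-κ²
/ (2 σ² t))`.

If `κ ≤ σ kbar1 t`, diffusion wins: the price is the Black-Scholes price with volatility `σ` up to
`O(t)`, and raising `σ` by a fixed proportion changes the price by much more than `t`. Lowering it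
does too, except near the upper end of the range, where the one-jump term supplies the lower bound
(`IsMertonModel.tendsto_impliedVol_of_le_kbar1`).

If `κ ≥ σ kbar1 t` and `κ / kbar2 t → a`, optimizing over a bounded `n` gives the exponent `mertonF
δ a * ℓ`. Since `mertonF δ 0 = 1`, the form `κ exp (-mertonF δ a * L)` also covers small `κ`
(`IsMertonModel.tendsto_impliedVol_of_tendsto_div_kbar2`).

If `κ² / L → ∞`, the number of jumps is unbounded and `n` jumps cost about `n L + κ² / (2 n δ²)`.
The minimum, at `n = κ / (δ √(2 L))`, is `q = κ √(2 L) / δ`. That single term gives the lower bound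
and an exponential moment the upper bound (`IsMertonModel.tendsto_impliedVol_of_many_jumps`).

The formula with the maximum follows by passing to ultrafilters, along which `κ / kbar2 t` converges
and one side of `σ kbar1 t` is chosen. -/

/-! ### The Black-Scholes price as a function of volatility. -/

/-- Price `E[(exp (m + w Z) - exp k)⁺]` of a call on a lognormal asset, with `Z` a standard
Gaussian random variable. -/
noncomputable def gaussCall (m w k : ℝ) : ℝ :=
  ∫ z, max (Real.exp (m + w * z) - Real.exp k) 0 ∂(gaussianReal 0 1)

/-- Upper tail function of the standard Gaussian distribution. -/
noncomputable def gaussTail (x : ℝ) : ℝ := ∫ z in Set.Ioi x, gaussianPDFReal 0 1 z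

theorem gaussianPDFReal_std (x : ℝ) :
    gaussianPDFReal 0 1 x = (√(2 * Real.pi))⁻¹ * Real.exp (-(x ^ 2 / 2)) := by
  simp only [gaussianPDFReal, NNReal.coe_one, mul_one, sub_zero, neg_div]

theorem continuous_gaussianPDFReal_std : Continuous (gaussianPDFReal 0 1) := by
  have : gaussianPDFReal 0 1 = fun x => (√(2 * Real.pi))⁻¹ * Real.exp (-(x ^ 2 / 2)) :=
    funext gaussianPDFReal_std
  rw [this]; fun_prop

theorem hasDerivAt_gaussTail (x : ℝ) : HasDerivAt gaussTail (-gaussianPDFReal 0 1 x) x := by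
  have hc := continuous_gaussianPDFReal_std
  have h : ∀ y, gaussTail y = gaussTail 0 - ∫ z in (0:ℝ)..y, gaussianPDFReal 0 1 z := by
    intro y
    have := intervalIntegral.integral_interval_add_Ioi (μ := volume)
      (f := gaussianPDFReal 0 1) (a := 0) (b := y)
      (integrable_gaussianPDFReal 0 1).integrableOn (integrable_gaussianPDFReal 0 1).integrableOn
    unfold gaussTail; linarith
  have h2 := (intervalIntegral.integral_hasDerivAt_right (hc.intervalIntegrable 0 x)
    (hc.stronglyMeasurableAtFilter _ _) hc.continuousAt).const_sub (gaussTail 0)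
  exact h2.congr_of_eventuallyEq (Eventually.of_forall h)

theorem integrable_exp_add_mul (m w : ℝ) :
    Integrable (fun z => Real.exp (m + w * z)) (gaussianReal 0 1) := by
  simp_rw [Real.exp_add]
  exact (integrable_exp_mul_gaussianReal w).const_mul _

theorem integral_exp_add_mul (m w : ℝ) :
    ∫ z, Real.exp (m + w * z) ∂(gaussianReal 0 1) = Real.exp (m + w ^ 2 / 2) := by
  simp_rw [Real.exp_add]
  rw [integral_const_mul]
  have := mgf_gaussianReal (p := gaussianReal 0 1) (X := fun x => x) (μ := 0) (v := 1)
    (by simp) w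
  rw [mgf] at this
  rw [this]; simp

theorem integrable_call_payoff {Ω : Type*} [MeasurableSpace Ω] {P : Measure Ω}
    [IsFiniteMeasure P] {Y : Ω → ℝ} (hY : Integrable Y P) (c : ℝ) :
    Integrable (fun ω => max (Y ω - c) 0) P :=
  (hY.sub (integrable_const c)).pos_part

theorem integrable_gaussCall (m w k : ℝ) :
    Integrable (fun z => max (Real.exp (m + w * z) - Real.exp k) 0) (gaussianReal 0 1) :=
  integrable_call_payoff (integrable_exp_add_mul m w) _

theorem bsCall_eq_gaussCall (k v : ℝ) : bsCall k v = gaussCall (-(v ^ 2 / 2)) v k := by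
  unfold bsCall gaussCall
  congr! 5; ring

theorem gaussCall_eq_bsCall (m w k : ℝ) :
    gaussCall m w k = Real.exp (m + w ^ 2 / 2) * bsCall (k - (m + w ^ 2 / 2)) w := by
  unfold bsCall gaussCall
  rw [← integral_const_mul]
  congr! 2 with z
  rw [mul_max_of_nonneg _ _ (Real.exp_nonneg _), mul_sub, ← Real.exp_add, ← Real.exp_add]
  ring_nf

theorem gaussCall_nonneg (m w k : ℝ) : 0 ≤ gaussCall m w k :=
  integral_nonneg fun _ => le_max_right _ _

theorem bsCall_nonneg (k v : ℝ) : 0 ≤ bsCall k v :=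
  integral_nonneg fun _ => le_max_right _ _

/-- The Black-Scholes formula. -/
theorem bsCall_eq_gaussTail (k : ℝ) {v : ℝ} (hv : 0 < v) :
    bsCall k v = gaussTail (k / v - v / 2) - Real.exp k * gaussTail (k / v + v / 2) := by
  have hint := integrable_gaussianPDFReal 0 1
  -- Tilting the Gaussian density by the asset price translates it by `v`.
  have hshift : ∀ z, gaussianPDFReal 0 1 (z - v) =
      gaussianPDFReal 0 1 z * Real.exp (v * z - v ^ 2 / 2) := by
    intro z
    rw [gaussianPDFReal_std, gaussianPDFReal_std, mul_assoc, ← Real.exp_add]; ring_nf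
  have h1 : gaussTail (k / v - v / 2) =
      ∫ z in Set.Ioi (k / v + v / 2), gaussianPDFReal 0 1 (z - v) := by
    unfold gaussTail
    rw [← integral_indicator measurableSet_Ioi, ← integral_indicator measurableSet_Ioi,
      ← integral_sub_right_eq_self _ v]
    congr with z
    simp only [Set.indicator, Set.mem_Ioi]
    congr 1
    rw [eq_iff_iff]; constructor <;> intro h <;> linarith
  have hint2 : Integrable (fun z => gaussianPDFReal 0 1 (z - v)) := hint.comp_sub_right v
  rw [h1, gaussTail, ← integral_const_mul, ← integral_sub hint2.integrableOn
    (hint.const_mul _).integrableOn, bsCall,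
    integral_gaussianReal_eq_integral_smul one_ne_zero, ← integral_indicator measurableSet_Ioi]
  congr with z
  simp only [Set.indicator, Set.mem_Ioi, smul_eq_mul, hshift]
  have hz : k / v + v / 2 < z ↔ k < v * z - v ^ 2 / 2 := by
    rw [← mul_lt_mul_iff_right₀ hv, mul_add, mul_div_cancel₀ _ hv.ne']
    constructor <;> intro h <;> nlinarith
  split_ifs with h <;> rw [hz] at h
  · rw [max_eq_left (sub_nonneg.2 (Real.exp_le_exp.2 h.le))]; ring
  · rw [max_eq_right (sub_nonpos.2 (Real.exp_le_exp.2 (not_lt.1 h))), mul_zero]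

/-- The derivative of the Black-Scholes price with respect to volatility. -/
theorem hasDerivAt_bsCall (k : ℝ) {v : ℝ} (hv : 0 < v) :
    HasDerivAt (bsCall k) (gaussianPDFReal 0 1 (k / v - v / 2)) v := by
  have hd1 : HasDerivAt (fun u : ℝ => k / u - u / 2) (-k / v ^ 2 - 1 / 2) v := by
    have := ((hasDerivAt_inv hv.ne').const_mul k).sub ((hasDerivAt_id v).div_const 2)
    simp only [div_eq_mul_inv] at this ⊢
    convert this using 1 <;> first | rfl | ring
  have hd2 : HasDerivAt (fun u : ℝ => k / u + u / 2) (-k / v ^ 2 + 1 / 2) v := by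
    have := ((hasDerivAt_inv hv.ne').const_mul k).add ((hasDerivAt_id v).div_const 2)
    simp only [div_eq_mul_inv] at this ⊢
    convert this using 1 <;> first | rfl | ring
  have h := ((hasDerivAt_gaussTail _).comp v hd1).sub
    (((hasDerivAt_gaussTail _).comp v hd2).const_mul (Real.exp k))
  -- This identity cancels the contributions of `-k / v ^ 2` from the two tails, leaving one
  -- density.
  have heq : Real.exp k * gaussianPDFReal 0 1 (k / v + v / 2) =
      gaussianPDFReal 0 1 (k / v - v / 2) := by
    rw [gaussianPDFReal_std, gaussianPDFReal_std, mul_left_comm, ← Real.exp_add]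
    congr 2
    field_simp; ring
  refine (h.congr_of_eventuallyEq ?_).congr_deriv ?_
  · filter_upwards [lt_mem_nhds hv] with u hu
    rw [bsCall_eq_gaussTail k hu]; rfl
  · linear_combination (-k / v ^ 2 + 1 / 2) * heq

theorem bsCall_zero {k : ℝ} (hk : 0 ≤ k) : bsCall k 0 = 0 := by
  simp [bsCall, hk]

theorem continuous_bsCall (k : ℝ) : Continuous (bsCall k) := by
  rw [continuous_iff_continuousAt]
  intro v₀
  have hM : ∀ᶠ v in 𝓝 v₀, |v| ≤ |v₀| + 1 :=
    (continuous_abs.continuousAt.eventually (gt_mem_nhds (lt_add_one |v₀|))).mono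
      fun v hv => le_of_lt hv
  refine continuousAt_of_dominated
    (bound := fun z => Real.exp (0 + (|v₀| + 1) * z) + Real.exp (0 + (-(|v₀| + 1)) * z)) ?_ ?_
    ((integrable_exp_add_mul _ _).add (integrable_exp_add_mul _ _)) ?_
  · exact Eventually.of_forall fun v => Measurable.aestronglyMeasurable (by fun_prop)
  · filter_upwards [hM] with v hv
    refine Eventually.of_forall fun z => ?_
    rw [Real.norm_of_nonneg (le_max_right _ _)]
    have hvz : v * z ≤ (|v₀| + 1) * |z| :=
      (le_abs_self _).trans (by rw [abs_mul]; gcongr)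
    refine max_le ?_ (by positivity)
    have h1 : Real.exp (v * z - v ^ 2 / 2) ≤ Real.exp ((|v₀| + 1) * |z|) :=
      Real.exp_le_exp.2 (by nlinarith [sq_nonneg v])
    have hk := Real.exp_pos k
    rcases abs_cases z with ⟨h, _⟩ | ⟨h, _⟩ <;> rw [h] at h1
    · have := Real.exp_pos (0 + (-(|v₀| + 1)) * z)
      rw [zero_add]; linarith
    · have := Real.exp_pos (0 + (|v₀| + 1) * z)
      rw [mul_neg, ← neg_mul] at h1
      rw [zero_add (-(|v₀| + 1) * z)]; linarith
  · exact Eventually.of_forall fun z => Continuous.continuousAt (by fun_prop)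

/-- The mean value theorem needs only continuity at the left end, so `u = 0` is allowed although the
derivative formula fails there. -/
theorem exists_bsCall_sub (k : ℝ) {u v : ℝ} (hu : 0 ≤ u) (huv : u < v) :
    ∃ ξ ∈ Set.Ioo u v,
      bsCall k v - bsCall k u = (v - u) * gaussianPDFReal 0 1 (k / ξ - ξ / 2) := by
  obtain ⟨ξ, hξ, h⟩ := exists_hasDerivAt_eq_slope (bsCall k)
    (fun x => gaussianPDFReal 0 1 (k / x - x / 2)) huv (continuous_bsCall k).continuousOn
    (fun x hx => hasDerivAt_bsCall k (hu.trans_lt hx.1))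
  refine ⟨ξ, hξ, ?_⟩
  rw [h, mul_div_cancel₀ _ (sub_pos.2 huv).ne']

theorem strictMonoOn_bsCall (k : ℝ) : StrictMonoOn (bsCall k) (Set.Ici 0) := by
  intro u hu v _ huv
  obtain ⟨ξ, _, h⟩ := exists_bsCall_sub k hu huv
  have := mul_pos (sub_pos.2 huv) (gaussianPDFReal_pos 0 1 (k / ξ - ξ / 2) one_ne_zero)
  linarith

theorem gaussianPDFReal_d1 (k : ℝ) {u : ℝ} (hu : 0 < u) :
    gaussianPDFReal 0 1 (k / u - u / 2) =
      (√(2 * Real.pi))⁻¹ * Real.exp (k / 2 - k ^ 2 / (2 * u ^ 2) - u ^ 2 / 8) := by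
  rw [gaussianPDFReal_std]
  congr 2
  field_simp; ring

theorem inv_sqrt_two_pi_le : (√(2 * Real.pi))⁻¹ ≤ 1 := by
  apply inv_le_one_of_one_le₀
  rw [Real.one_le_sqrt]
  linarith [Real.pi_gt_three]

theorem third_le_inv_sqrt_two_pi : 1 / 3 ≤ (√(2 * Real.pi))⁻¹ := by
  rw [one_div]
  apply inv_anti₀ (by positivity)
  rw [Real.sqrt_le_left (by norm_num)]
  linarith [Real.pi_lt_four]

/-- The price grows from `0` at zero volatility, and `exp (-k² / (2 ξ²))` increases with `ξ`, so its
value at `v` bounds it along the way. -/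
theorem bsCall_le {k v : ℝ} (hk : 0 ≤ k) (hv : 0 < v) :
    bsCall k v ≤ v * Real.exp (k / 2 - k ^ 2 / (2 * v ^ 2)) := by
  obtain ⟨ξ, hξ, h⟩ := exists_bsCall_sub k le_rfl hv
  rw [bsCall_zero hk, sub_zero, sub_zero, gaussianPDFReal_d1 k hξ.1] at h
  rw [h]
  gcongr
  refine (mul_le_of_le_one_left (Real.exp_nonneg _) inv_sqrt_two_pi_le).trans ?_
  apply Real.exp_le_exp.2
  have h0 := hξ.1
  have h1 : k ^ 2 / (2 * v ^ 2) ≤ k ^ 2 / (2 * ξ ^ 2) := by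
    gcongr; exact hξ.2.le
  nlinarith [sq_nonneg ξ]

theorem le_bsCall_sub {k u v : ℝ} (hk : 0 ≤ k) (hu : 0 < u) (huv : u < v) :
    (v - u) / 3 * Real.exp (-(k ^ 2 / (2 * u ^ 2)) - v ^ 2 / 8) ≤ bsCall k v - bsCall k u := by
  obtain ⟨ξ, hξ, h⟩ := exists_bsCall_sub k hu.le huv
  have h0 := hu.trans hξ.1
  rw [gaussianPDFReal_d1 k h0] at h
  rw [h, div_eq_mul_one_div, mul_assoc]
  have h1 : k ^ 2 / (2 * ξ ^ 2) ≤ k ^ 2 / (2 * u ^ 2) := by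
    gcongr; exact hξ.1.le
  have h2 : ξ ^ 2 ≤ v ^ 2 := by gcongr; exact hξ.2.le
  have h3 := sub_nonneg.2 huv.le
  gcongr
  · exact third_le_inv_sqrt_two_pi
  · linarith

/-- Since `min x y ≤ √(x y)`, the payoff `(x - y)⁺ = x - min x y` is at least `x - √(x y)`. The
bound forces the price to `1` as `v → ∞`, so every smaller model price is attained. -/
theorem le_bsCall (k v : ℝ) : 1 - Real.exp (k / 2 - v ^ 2 / 8) ≤ bsCall k v := by
  have h1 : ∫ z, (Real.exp (-(v ^ 2 / 2) + v * z) -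
      Real.exp ((k / 2 - v ^ 2 / 4) + (v / 2) * z)) ∂(gaussianReal 0 1) =
      1 - Real.exp (k / 2 - v ^ 2 / 8) := by
    rw [integral_sub (integrable_exp_add_mul _ _) (integrable_exp_add_mul _ _),
      integral_exp_add_mul, integral_exp_add_mul]
    congr 1
    · simp
    · ring_nf
  rw [← h1, bsCall_eq_gaussCall]
  refine integral_mono ((integrable_exp_add_mul _ _).sub (integrable_exp_add_mul _ _))
    (integrable_gaussCall _ _ _) fun z => ?_
  simp only
  set a := Real.exp ((-(v ^ 2 / 2) + v * z) / 2) with ha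
  set b := Real.exp (k / 2) with hb
  have e1 : Real.exp (-(v ^ 2 / 2) + v * z) = a ^ 2 := by
    rw [ha, ← Real.exp_nat_mul]; congr 1; push_cast; ring
  have e2 : Real.exp k = b ^ 2 := by
    rw [hb, ← Real.exp_nat_mul]; congr 1; push_cast; ring
  have e3 : Real.exp ((k / 2 - v ^ 2 / 4) + (v / 2) * z) = a * b := by
    rw [ha, hb, ← Real.exp_add]; congr 1; ring
  rw [e1, e2, e3]
  have ha0 : 0 < a := Real.exp_pos _
  have hb0 : 0 < b := Real.exp_pos _
  rcases le_total a b with h | h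
  · exact le_max_of_le_right (by nlinarith)
  · exact le_max_of_le_left (by nlinarith)

theorem bsCall_le_bsCall_add (k k' v : ℝ) :
    bsCall k v ≤ bsCall k' v + |Real.exp k - Real.exp k'| := by
  rw [bsCall_eq_gaussCall, bsCall_eq_gaussCall]
  have h : ∫ z, (max (Real.exp (-(v ^ 2 / 2) + v * z) - Real.exp k') 0 +
      |Real.exp k - Real.exp k'|) ∂(gaussianReal 0 1) =
      gaussCall (-(v ^ 2 / 2)) v k' + |Real.exp k - Real.exp k'| := by
    rw [integral_add (integrable_gaussCall _ _ _) (integrable_const _)]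
    simp [gaussCall]
  rw [← h]
  refine integral_mono (integrable_gaussCall _ _ _)
    ((integrable_gaussCall _ _ _).add (integrable_const _)) fun z => ?_
  simp only
  have := neg_abs_le (Real.exp k - Real.exp k')
  refine max_le ?_ (add_nonneg (le_max_right _ _) (abs_nonneg _))
  have := le_max_left (Real.exp (-(v ^ 2 / 2) + v * z) - Real.exp k') 0
  linarith

theorem bsCall_le_one (k v : ℝ) : bsCall k v ≤ 1 := by
  have h1 : ∫ z, Real.exp (-(v ^ 2 / 2) + v * z) ∂(gaussianReal 0 1) = 1 := by
    rw [integral_exp_add_mul]; simp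
  rw [← h1, bsCall_eq_gaussCall]
  refine integral_mono (integrable_gaussCall _ _ _) (integrable_exp_add_mul _ _) fun z => ?_
  exact max_le (by linarith [Real.exp_pos k]) (Real.exp_nonneg _)

/-! ### Exponential upper bounds and Gaussian lower bounds for lognormal calls. -/

/-- Pointwise Chernoff bound for a call payoff. -/
theorem call_payoff_le_exp {s : ℝ} (hs : 0 ≤ s) (x k : ℝ) :
    max (Real.exp x - Real.exp k) 0 ≤ Real.exp (-(s * k) + (1 + s) * x) := by
  refine max_le ?_ (Real.exp_nonneg _)
  rcases le_total x k with h | h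
  · have := Real.exp_le_exp.2 h
    linarith [Real.exp_nonneg (-(s * k) + (1 + s) * x)]
  · have : Real.exp x ≤ Real.exp (-(s * k) + (1 + s) * x) :=
      Real.exp_le_exp.2 (by nlinarith)
    linarith [Real.exp_pos k]

theorem gaussCall_le_exp {s : ℝ} (hs : 0 ≤ s) (m w k : ℝ) :
    gaussCall m w k ≤ Real.exp (-(s * k) + (1 + s) * m + (1 + s) ^ 2 * w ^ 2 / 2) := by
  have h1 : ∫ z, Real.exp ((-(s * k) + (1 + s) * m) + ((1 + s) * w) * z) ∂(gaussianReal 0 1) =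
      Real.exp (-(s * k) + (1 + s) * m + (1 + s) ^ 2 * w ^ 2 / 2) := by
    rw [integral_exp_add_mul, mul_pow]
  rw [← h1]
  refine integral_mono (integrable_gaussCall _ _ _) (integrable_exp_add_mul _ _) fun z => ?_
  refine (call_payoff_le_exp hs _ k).trans (le_of_eq ?_)
  congr 1; ring

theorem le_gaussTail (y : ℝ) : 1 / 3 * Real.exp (-((|y| + 1) ^ 2 / 2)) ≤ gaussTail y := by
  have hc := continuous_gaussianPDFReal_std
  have h1 : ∫ z in Set.Ioc y (y + 1), gaussianPDFReal 0 1 z ≤ gaussTail y :=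
    setIntegral_mono_set (integrable_gaussianPDFReal 0 1).integrableOn
      (Eventually.of_forall fun z => gaussianPDFReal_nonneg 0 1 z)
      (LE.le.eventuallyLE Set.Ioc_subset_Ioi_self)
  refine le_trans ?_ h1
  have h2 : ∫ _ in Set.Ioc y (y + 1), 1 / 3 * Real.exp (-((|y| + 1) ^ 2 / 2)) =
      1 / 3 * Real.exp (-((|y| + 1) ^ 2 / 2)) := by simp
  rw [← h2]
  refine setIntegral_mono_on continuous_const.integrableOn_Ioc (integrable_gaussianPDFReal 0 1).integrableOn
    measurableSet_Ioc fun z hz => ?_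
  rw [gaussianPDFReal_std]
  gcongr ?_ * Real.exp ?_
  · exact third_le_inv_sqrt_two_pi
  · have : |z| ≤ |y| + 1 := by
      have := abs_add_le y (z - y)
      rw [abs_of_nonneg (sub_nonneg.2 hz.1.le)] at this
      have h3 := hz.2
      rw [add_sub_cancel] at this
      linarith
    have : z ^ 2 ≤ (|y| + 1) ^ 2 := by rw [← sq_abs z]; gcongr
    linarith

/-- When the log-price exceeds `k + 1` the payoff is at least `exp k * (e - 1) ≥ 1`, so the price
dominates a Gaussian tail. -/
theorem le_gaussCall {k w : ℝ} (hk : 0 ≤ k) (m : ℝ) (hw : 0 < w) :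
    1 / 3 * Real.exp (-((|k + 1 - m| / w + 1) ^ 2 / 2)) ≤ gaussCall m w k := by
  set y := (k + 1 - m) / w with hy
  have habs : |k + 1 - m| / w = |y| := by rw [hy, abs_div, abs_of_pos hw]
  rw [habs]
  refine (le_gaussTail y).trans ?_
  have h1 : gaussTail y =
      ∫ z, (Set.Ioi y).indicator (fun _ => (1:ℝ)) z ∂(gaussianReal 0 1) := by
    rw [integral_gaussianReal_eq_integral_smul one_ne_zero, gaussTail,
      ← integral_indicator measurableSet_Ioi]
    congr with z
    by_cases hz : z ∈ Set.Ioi y <;> simp [hz]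
  rw [h1]
  refine integral_mono ((integrable_const _).indicator measurableSet_Ioi)
    (integrable_gaussCall _ _ _) fun z => ?_
  by_cases hz : z ∈ Set.Ioi y
  · rw [Set.indicator_of_mem hz]
    refine le_max_of_le_left ?_
    have h2 : k + 1 ≤ m + w * z := by
      have : k + 1 - m < z * w := (div_lt_iff₀ hw).1 hz
      linarith
    have h3 := Real.exp_le_exp.2 h2
    rw [Real.exp_add] at h3
    have h4 := Real.one_le_exp hk
    have h5 := Real.add_one_le_exp (1:ℝ)
    nlinarith
  · rw [Set.indicator_of_notMem hz]
    exact le_max_right _ _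

/-! ### From the exponent of the price to the volatility. -/

/-- If `c` is logarithmically equivalent to `κ exp (-q)`, then `κ / √(2 q)` approximates the
volatility at which the Black-Scholes price is `c`. -/
theorem eventually_bsCall_bracket {ι : Type*} {l : Filter ι} {κ q c : ι → ℝ}
    (hκ : ∀ᶠ i in l, 0 < κ i) (hq : Tendsto q l atTop)
    (hκq : Tendsto (fun i => κ i / q i) l (𝓝 0))
    (hlo : ∀ ε : ℝ, 0 < ε → ∀ᶠ i in l, κ i * Real.exp (-((1 + ε) * q i)) ≤ c i)
    (hup : ∀ ε : ℝ, 0 < ε → ∀ᶠ i in l, c i ≤ κ i * Real.exp (-((1 - ε) * q i)))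
    {ε : ℝ} (hε : 0 < ε) (hε1 : ε < 1) :
    ∀ᶠ i in l, bsCall (κ i) ((1 - ε) * (κ i / √(2 * q i))) ≤ c i ∧
      c i ≤ bsCall (κ i) ((1 + ε) * (κ i / √(2 * q i))) := by
  -- The threshold `1536 / ε ^ 3` is what makes `12 r / ε ≤ (ε r / 8) ^ 2 / 2`, so that `exp (ε r /
  -- 8)` absorbs the prefactor `6 √(2 r) / ε` below.
  filter_upwards [hκ, hq.eventually_ge_atTop 1, hq.eventually_ge_atTop (1536 / ε ^ 3),
    hκq.eventually (gt_mem_nhds (show (0:ℝ) < ε / 2 by positivity)), hlo ε hε,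
    hup (ε / 4) (by positivity)] with i hκi hq1 hq2 hκqi hloi hupi
  set k := κ i
  set r := q i
  have hr : 0 < r := by linarith
  have hkr : k ≤ ε / 2 * r := ((div_lt_iff₀ hr).1 hκqi).le
  have hs1 : 1 ≤ √(2 * r) := by rw [Real.one_le_sqrt]; linarith
  have hs2 : √(2 * r) ≤ 2 * r := Real.sqrt_le_iff.2 ⟨by linarith, by nlinarith⟩
  have hs0 : 0 < √(2 * r) := by linarith
  have hw : 0 < k / √(2 * r) := by positivity
  have hwk : k / √(2 * r) ≤ k := div_le_self hκi.le hs1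
  have hwsq : (k / √(2 * r)) ^ 2 = k ^ 2 / (2 * r) := by
    rw [div_pow, Real.sq_sqrt (by linarith)]
  have hexp : ∀ a : ℝ, 0 < a → k ^ 2 / (2 * (a * (k / √(2 * r))) ^ 2) = r / a ^ 2 := by
    intro a ha
    rw [mul_pow, hwsq]; field_simp
  constructor
  · refine le_trans ?_ hloi
    have h1e : 0 < 1 - ε := by linarith
    refine (bsCall_le hκi.le (mul_pos h1e hw)).trans ?_
    rw [hexp _ h1e]
    gcongr
    · nlinarith
    · have : (1 + 2 * ε) * r ≤ r / (1 - ε) ^ 2 := by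
        rw [le_div_iff₀ (by positivity)]
        have : (1 + 2 * ε) * (1 - ε) ^ 2 ≤ 1 := by nlinarith [pow_pos hε 2, pow_pos hε 3]
        nlinarith
      nlinarith
  -- The increment from `(1 + ε / 2) w` to `(1 + ε) w` alone is large enough. The exponent budget is
  -- exact: `ε / 2` gained from `(1 + ε / 2) ^ 2` pays `ε / 4` for the bound on `c`, `ε / 8` for the
  -- prefactor and `ε / 8` for `v² / 8`.
  · refine hupi.trans ?_
    set w := k / √(2 * r) with hwdef
    have hgap := le_bsCall_sub hκi.le (mul_pos (show (0:ℝ) < 1 + ε / 2 by linarith) hw)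
      (show (1 + ε / 2) * w < (1 + ε) * w by gcongr; linarith)
    have hnn := bsCall_nonneg k ((1 + ε / 2) * w)
    refine le_trans ?_ (show _ ≤ _ by linarith [hgap] :
      ((1 + ε) * w - (1 + ε / 2) * w) / 3 * Real.exp (-(k ^ 2 / (2 * ((1 + ε / 2) * w) ^ 2)) -
        ((1 + ε) * w) ^ 2 / 8) ≤ _)
    rw [hexp _ (by linarith)]
    have h1 : r / (1 + ε / 2) ^ 2 ≤ (1 - ε / 2) * r := by
      rw [div_le_iff₀ (by positivity)]
      have : 1 ≤ (1 - ε / 2) * (1 + ε / 2) ^ 2 := by nlinarith [pow_pos hε 2, pow_pos hε 3]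
      nlinarith
    have h2 : ((1 + ε) * w) ^ 2 / 8 ≤ ε / 8 * r := by
      rw [mul_pow, hwsq]
      have h3 : k ^ 2 / (2 * r) ≤ ε ^ 2 / 8 * r := by
        rw [div_le_iff₀ (by linarith)]; nlinarith
      have h4 : (1 + ε) ^ 2 ≤ 4 := by nlinarith
      calc (1 + ε) ^ 2 * (k ^ 2 / (2 * r)) / 8 ≤ 4 * (ε ^ 2 / 8 * r) / 8 := by gcongr
        _ ≤ ε / 8 * r := by nlinarith
    have h5 : 6 / ε * √(2 * r) ≤ Real.exp (ε / 8 * r) := by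
      have h6 := Real.quadratic_le_exp_of_nonneg (show 0 ≤ ε / 8 * r by positivity)
      have h7 : 1536 ≤ r * ε ^ 3 := (div_le_iff₀ (by positivity)).1 hq2
      have h8 : 6 / ε * √(2 * r) ≤ 12 * r / ε := by
        calc 6 / ε * √(2 * r) ≤ 6 / ε * (2 * r) := by gcongr
          _ = 12 * r / ε := by ring
      have h9 : 12 * r / ε ≤ (ε / 8 * r) ^ 2 / 2 := by
        rw [div_le_iff₀ hε]; nlinarith
      have : 0 < ε / 8 * r := by positivity
      linarith
    have h6 : k * Real.exp (-((1 - ε / 4) * r)) =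
        ε / 6 * w * (6 / ε * √(2 * r)) * Real.exp (-((1 - ε / 4) * r)) := by
      rw [hwdef]; field_simp
    rw [h6]
    calc ε / 6 * w * (6 / ε * √(2 * r)) * Real.exp (-((1 - ε / 4) * r))
        ≤ ε / 6 * w * Real.exp (ε / 8 * r) * Real.exp (-((1 - ε / 4) * r)) := by gcongr
      _ = ε / 6 * w * Real.exp (ε / 8 * r + -((1 - ε / 4) * r)) := by rw [mul_assoc, Real.exp_add]
      _ ≤ ε / 6 * w * Real.exp (-(r / (1 + ε / 2) ^ 2) - ((1 + ε) * w) ^ 2 / 8) := by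
        gcongr; linarith
      _ = _ := by ring

/-! ### The law of the log-price as a Poisson mixture of Gaussian laws. -/

/-- The probability of `n` jumps before time `t`. -/
noncomputable def jumpWeight (lam t : ℝ) (n : ℕ) : ℝ :=
  Real.exp (-(lam * t)) * (lam * t) ^ n / n.factorial

theorem jumpWeight_nonneg {lam t : ℝ} (hl : 0 ≤ lam) (ht : 0 ≤ t) (n : ℕ) :
    0 ≤ jumpWeight lam t n := by
  unfold jumpWeight; positivity

theorem hasSum_jumpWeight_mul_pow (lam t : ℝ) (z : ℂ) :
    HasSum (fun n => (jumpWeight lam t n : ℂ) * z ^ n)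
      (Complex.exp ((lam * t : ℝ) * (z - 1))) := by
  have h := (NormedSpace.expSeries_div_hasSum_exp (((lam * t : ℝ) : ℂ) * z)).mul_left
    (Complex.exp (-((lam * t : ℝ) : ℂ)))
  rw [← Complex.exp_eq_exp_ℂ, ← Complex.exp_add] at h
  have he : ((lam * t : ℝ) : ℂ) * (z - 1) = -((lam * t : ℝ) : ℂ) + ((lam * t : ℝ) : ℂ) * z := by
    ring
  rw [he]
  refine h.congr_fun fun n => ?_
  simp only [jumpWeight, mul_pow]
  push_cast
  ring

theorem hasSum_jumpWeight (lam t : ℝ) : HasSum (jumpWeight lam t) 1 := by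
  have h := hasSum_jumpWeight_mul_pow lam t 1
  simp only [one_pow, mul_one, sub_self, mul_zero, Complex.exp_zero] at h
  exact Complex.hasSum_ofReal.1 (by simpa using h)

/-- The Poisson mixture of Gaussian laws that is the law of the log-price in Merton's model. -/
noncomputable def mertonLaw (μ α σ lam δ t : ℝ) : Measure ℝ :=
  Measure.sum fun n : ℕ => ENNReal.ofReal (jumpWeight lam t n) •
    gaussianReal (μ * t + n * α) (σ ^ 2 * t + n * δ ^ 2).toNNReal

theorem isProbabilityMeasure_mertonLaw (μ α σ δ : ℝ) {lam t : ℝ} (hl : 0 ≤ lam) (ht : 0 ≤ t) :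
    IsProbabilityMeasure (mertonLaw μ α σ lam δ t) := by
  constructor
  rw [mertonLaw, Measure.sum_apply _ MeasurableSet.univ]
  simp only [Measure.smul_apply, measure_univ, smul_eq_mul, mul_one]
  rw [← ENNReal.ofReal_tsum_of_nonneg (jumpWeight_nonneg hl ht) (hasSum_jumpWeight lam t).summable,
    (hasSum_jumpWeight lam t).tsum_eq, ENNReal.ofReal_one]

theorem hasSum_integral_mertonLaw {E : Type*} [NormedAddCommGroup E] [NormedSpace ℝ E]
    (μ α σ δ : ℝ) {lam t : ℝ} (hl : 0 ≤ lam) (ht : 0 ≤ t) {f : ℝ → E}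
    (hf : Integrable f (mertonLaw μ α σ lam δ t)) :
    HasSum (fun n : ℕ => jumpWeight lam t n •
      ∫ x, f x ∂(gaussianReal (μ * t + n * α) (σ ^ 2 * t + n * δ ^ 2).toNNReal))
      (∫ x, f x ∂(mertonLaw μ α σ lam δ t)) := by
  have h := hasSum_integral_measure hf
  simp only [integral_smul_measure, ENNReal.toReal_ofReal (jumpWeight_nonneg hl ht _)] at h
  exact h

theorem charFun_mertonLaw (μ α σ δ : ℝ) {lam t : ℝ} (hl : 0 ≤ lam) (ht : 0 ≤ t) (x : ℝ) :
    charFun (mertonLaw μ α σ lam δ t) x =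
      Complex.exp ((t : ℂ) * ((x * Complex.I) * (μ : ℂ) + 1 / 2 * (x * Complex.I) ^ 2 * (σ : ℂ) ^ 2
      + (lam : ℂ) * (Complex.exp ((x * Complex.I) * (α : ℂ) +
        (x * Complex.I) ^ 2 * ((δ : ℂ) ^ 2 / 2)) - 1))) := by
  have := isProbabilityMeasure_mertonLaw μ α σ δ hl ht
  rw [charFun_apply_real]
  have hint : Integrable (fun y : ℝ => Complex.exp (x * y * Complex.I))
      (mertonLaw μ α σ lam δ t) := by
    refine Integrable.of_bound (C := 1) (Continuous.aestronglyMeasurable (by fun_prop))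
      (Eventually.of_forall fun y => ?_)
    rw [← Complex.ofReal_mul, Complex.norm_exp_ofReal_mul_I]
  have h1 := hasSum_integral_mertonLaw μ α σ δ hl ht hint
  simp only [← charFun_apply_real, charFun_gaussianReal] at h1
  have h2 := (hasSum_jumpWeight_mul_pow lam t (Complex.exp ((x * Complex.I) * (α : ℂ) +
        (x * Complex.I) ^ 2 * ((δ : ℂ) ^ 2 / 2)))).mul_left
        (Complex.exp ((t : ℂ) * ((x * Complex.I) * (μ : ℂ) +
          1 / 2 * (x * Complex.I) ^ 2 * (σ : ℂ) ^ 2)))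
  rw [← Complex.exp_add] at h2
  rw [charFun_apply_real] at h1
  have h3 := h1.unique (h2.congr_fun ?_)
  · rw [h3]; congr 1; push_cast; ring
  · intro n
    have hv : 0 ≤ σ ^ 2 * t + n * δ ^ 2 := by positivity
    rw [Real.coe_toNNReal _ hv, ← Complex.exp_nat_mul, Complex.real_smul, mul_left_comm,
      ← Complex.exp_add]
    congr 2
    push_cast
    rw [mul_pow, Complex.I_sq]
    ring

theorem integral_gaussianReal_eq_std {E : Type*} [NormedAddCommGroup E] [NormedSpace ℝ E]
    (m : ℝ) {v : ℝ} (hv : 0 ≤ v) {f : ℝ → E} (hf : StronglyMeasurable f) :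
    ∫ x, f x ∂(gaussianReal m v.toNNReal) = ∫ z, f (m + √v * z) ∂(gaussianReal 0 1) := by
  have h : gaussianReal m v.toNNReal = (gaussianReal 0 1).map (fun z => m + √v * z) := by
    have h1 := gaussianReal_map_const_mul (μ := 0) (v := 1) (√v)
    have h2 := gaussianReal_map_const_add (μ := √v * 0) (v := NNReal.mk (√v ^ 2) (sq_nonneg _) * 1) m
    rw [← h1, Measure.map_map (by fun_prop) (by fun_prop)] at h2
    have h3 : NNReal.mk (√v ^ 2) (sq_nonneg _) * 1 = v.toNNReal := by
      ext; simp [Real.sq_sqrt hv, hv]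
    rw [h3] at h2
    rw [mul_zero, zero_add] at h2
    exact h2.symm
  rw [h, integral_map (by fun_prop) hf.aestronglyMeasurable]

/-! ### The call price as a series over the number of jumps; existence of the implied volatility. -/

section Model

variable {Ω : Type*} [MeasurableSpace Ω] {P : Measure Ω} [IsProbabilityMeasure P]
  {X : ℝ → Ω → ℝ} {μ α σ lam δ : ℝ}

/-- The transform on the imaginary axis is the characteristic function, which determines the law. -/
theorem IsMertonModel.map_eq (hX : IsMertonModel P X μ α σ lam δ) {t : ℝ} (ht : 0 < t) :
    P.map (X t) = mertonLaw μ α σ lam δ t := by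
  have := isProbabilityMeasure_mertonLaw μ α σ δ hX.lam_pos.le ht.le
  have := Measure.isProbabilityMeasure_map (hX.aemeasurable t ht)
  apply Measure.ext_of_charFun
  ext x
  rw [charFun_mertonLaw μ α σ δ hX.lam_pos.le ht.le, ← complexMGF_mul_I (hX.aemeasurable t ht),
    hX.mgf_eq t ht]

omit [IsProbabilityMeasure P] in
theorem IsMertonModel.mgf_real (hX : IsMertonModel P X μ α σ lam δ) {t : ℝ} (ht : 0 < t) (p : ℝ) :
    ∫ ω, Real.exp (p * X t ω) ∂P = Real.exp (t * (p * μ + 1 / 2 * p ^ 2 * σ ^ 2 +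
      lam * (Real.exp (p * α + p ^ 2 * (δ ^ 2 / 2)) - 1))) := by
  have h := hX.mgf_eq t ht p
  rw [complexMGF_ofReal, mgf] at h
  apply Complex.ofReal_injective
  rw [h]
  push_cast
  rfl

omit [IsProbabilityMeasure P] in
theorem IsMertonModel.integrable_exp_mul (hX : IsMertonModel P X μ α σ lam δ) {t : ℝ}
    (ht : 0 < t) (p : ℝ) : Integrable (fun ω => Real.exp (p * X t ω)) P := by
  -- A non-integrable function would have Bochner integral `0`, whereas the transform is a positive
  -- exponential.
  by_contra h
  have h1 := hX.mgf_real ht p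
  rw [integral_undef h] at h1
  exact absurd h1 (Real.exp_pos _).ne

omit [IsProbabilityMeasure P] in
theorem IsMertonModel.integrable_exp (hX : IsMertonModel P X μ α σ lam δ) {t : ℝ}
    (ht : 0 < t) : Integrable (fun ω => Real.exp (X t ω)) P := by
  simpa using hX.integrable_exp_mul ht 1

theorem IsMertonModel.hasSum_callPrice (hX : IsMertonModel P X μ α σ lam δ) {t : ℝ}
    (ht : 0 < t) (k : ℝ) :
    HasSum (fun n : ℕ => jumpWeight lam t n *
      gaussCall (μ * t + n * α) √(σ ^ 2 * t + n * δ ^ 2) k) (callPrice P X k t) := by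
  have hm := hX.aemeasurable t ht
  have hsm : StronglyMeasurable fun x : ℝ => max (Real.exp x - Real.exp k) 0 :=
    Continuous.stronglyMeasurable (by fun_prop)
  have hint : Integrable (fun x => max (Real.exp x - Real.exp k) 0)
      (mertonLaw μ α σ lam δ t) := by
    rw [← hX.map_eq ht, integrable_map_measure hsm.aestronglyMeasurable hm]
    exact integrable_call_payoff (hX.integrable_exp ht) _
  have h := hasSum_integral_mertonLaw μ α σ δ hX.lam_pos.le ht.le hint
  rw [← hX.map_eq ht, integral_map hm hsm.aestronglyMeasurable] at h
  refine h.congr_fun fun n => ?_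
  rw [integral_gaussianReal_eq_std _ (by positivity) hsm]
  rfl

theorem IsMertonModel.jumpWeight_mul_le_callPrice (hX : IsMertonModel P X μ α σ lam δ) {t : ℝ}
    (ht : 0 < t) (k : ℝ) (n : ℕ) :
    jumpWeight lam t n * gaussCall (μ * t + n * α) √(σ ^ 2 * t + n * δ ^ 2) k ≤
      callPrice P X k t :=
  le_hasSum (hX.hasSum_callPrice ht k) n fun _ _ =>
    mul_nonneg (jumpWeight_nonneg hX.lam_pos.le ht.le _) (gaussCall_nonneg _ _ _)

theorem IsMertonModel.callPrice_pos (hX : IsMertonModel P X μ α σ lam δ) {k t : ℝ}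
    (hk : 0 ≤ k) (ht : 0 < t) : 0 < callPrice P X k t := by
  refine lt_of_lt_of_le ?_ (hX.jumpWeight_mul_le_callPrice ht k 0)
  have h1 := hX.lam_pos
  have h2 := hX.sigma_pos
  have h3 : 0 < jumpWeight lam t 0 := by unfold jumpWeight; positivity
  refine mul_pos h3 (lt_of_lt_of_le ?_ (le_gaussCall hk _ (by positivity)))
  positivity

theorem IsMertonModel.callPrice_lt_one (hX : IsMertonModel P X μ α σ lam δ) {k t : ℝ}
    (ht : 0 < t) : callPrice P X k t < 1 := by
  rw [← hX.risk_neutral t ht, callPrice]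
  have hi := integrable_call_payoff (hX.integrable_exp ht) (Real.exp k)
  have hlt : ∀ ω, max (Real.exp (X t ω) - Real.exp k) 0 < Real.exp (X t ω) := fun ω =>
    max_lt (by linarith [Real.exp_pos k]) (Real.exp_pos _)
  rw [← sub_pos, ← integral_sub (hX.integrable_exp ht) hi,
    integral_pos_iff_support_of_nonneg (fun ω => sub_nonneg.2 (hlt ω).le)
      ((hX.integrable_exp ht).sub hi)]
  have : (Function.support fun ω =>
      Real.exp (X t ω) - max (Real.exp (X t ω) - Real.exp k) 0) = Set.univ :=
    Set.eq_univ_of_forall fun ω => (sub_pos.2 (hlt ω)).ne'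
  simp [this]

theorem IsMertonModel.callPrice_le_exp (hX : IsMertonModel P X μ α σ lam δ) {s t : ℝ}
    (hs : 0 ≤ s) (ht : 0 < t) (k : ℝ) :
    callPrice P X k t ≤ Real.exp (-(s * k) + t * ((1 + s) * μ + 1 / 2 * (1 + s) ^ 2 * σ ^ 2 +
      lam * (Real.exp ((1 + s) * α + (1 + s) ^ 2 * (δ ^ 2 / 2)) - 1))) := by
  rw [Real.exp_add, ← hX.mgf_real ht (1 + s), ← integral_const_mul]
  refine integral_mono (integrable_call_payoff (hX.integrable_exp ht) _)
    ((hX.integrable_exp_mul ht _).const_mul _) fun ω => ?_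
  simp only
  rw [← Real.exp_add]
  exact call_payoff_le_exp hs _ _

/-- All but the first `N` terms of the price series contribute at most `O(t ^ N)`. -/
theorem IsMertonModel.callPrice_le_sum_add (hX : IsMertonModel P X μ α σ lam δ) :
    ∃ C : ℝ, 0 < C ∧ ∀ (N : ℕ) (k t : ℝ), 0 < t → t ≤ 1 →
      callPrice P X k t ≤ ∑ n ∈ Finset.range N, jumpWeight lam t n *
        gaussCall (μ * t + n * α) √(σ ^ 2 * t + n * δ ^ 2) k + C * t ^ N := by
  -- `ρ` is the mean multiplicative effect of one jump on the price. Bounding each call by the mean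
  -- of its asset makes `C` independent of `N` and `k`.
  set ρ := Real.exp (α + δ ^ 2 / 2)
  have hl := hX.lam_pos
  have hρ : 0 < ρ := Real.exp_pos _
  refine ⟨Real.exp |μ + σ ^ 2 / 2| * Real.exp (lam * ρ), by positivity, fun N k t ht ht1 => ?_⟩
  set F : ℕ → ℝ := fun n => jumpWeight lam t n *
        gaussCall (μ * t + n * α) √(σ ^ 2 * t + n * δ ^ 2) k with hF
  have hsum := hX.hasSum_callPrice ht k
  have hbound : ∀ n, F (n + N) ≤ Real.exp |μ + σ ^ 2 / 2| * t ^ N *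
      ((lam * ρ) ^ (n + N) / (n + N).factorial) := by
    intro n
    have h1 : jumpWeight lam t (n + N) ≤ (lam * t) ^ (n + N) / (n + N).factorial := by
      unfold jumpWeight
      gcongr
      refine mul_le_of_le_one_left (by positivity) (Real.exp_le_one_iff.2 ?_)
      have := mul_pos hl ht
      linarith
    have h2 : gaussCall (μ * t + (n + N : ℕ) * α) √(σ ^ 2 * t + (n + N : ℕ) * δ ^ 2) k ≤
        Real.exp |μ + σ ^ 2 / 2| * ρ ^ (n + N) := by
      refine (gaussCall_le_exp le_rfl _ _ k).trans ?_
      rw [Real.sq_sqrt (by positivity), ← Real.exp_nat_mul, ← Real.exp_add]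
      apply Real.exp_le_exp.2
      have h3 : (μ + σ ^ 2 / 2) * t ≤ |μ + σ ^ 2 / 2| :=
        (mul_le_mul_of_nonneg_right (le_abs_self _) ht.le).trans
          (mul_le_of_le_one_right (abs_nonneg _) ht1)
      linarith
    have h3 : t ^ (n + N) ≤ t ^ N := pow_le_pow_of_le_one ht.le ht1 (Nat.le_add_left _ _)
    calc F (n + N) ≤ (lam * t) ^ (n + N) / (n + N).factorial *
          (Real.exp |μ + σ ^ 2 / 2| * ρ ^ (n + N)) :=
        mul_le_mul h1 h2 (gaussCall_nonneg _ _ _) (by positivity)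
      _ = Real.exp |μ + σ ^ 2 / 2| * t ^ (n + N) * ((lam * ρ) ^ (n + N) / (n + N).factorial) := by
        rw [mul_pow, mul_pow]; ring
      _ ≤ _ := by gcongr
  have hexp := NormedSpace.expSeries_div_hasSum_exp (lam * ρ)
  rw [← Real.exp_eq_exp_ℝ] at hexp
  have htail : ∑' n, (lam * ρ) ^ (n + N) / (n + N).factorial ≤ Real.exp (lam * ρ) := by
    rw [← hexp.tsum_eq, ← hexp.summable.sum_add_tsum_nat_add N]
    have : 0 ≤ ∑ n ∈ Finset.range N, (lam * ρ) ^ n / n.factorial :=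
      Finset.sum_nonneg fun n _ => by positivity
    linarith
  have hsummable := (summable_nat_add_iff N).2 hexp.summable
  rw [← hsum.tsum_eq, ← hsum.summable.sum_add_tsum_nat_add N]
  gcongr
  calc ∑' n, F (n + N) ≤ ∑' n : ℕ, Real.exp |μ + σ ^ 2 / 2| * t ^ N *
        ((lam * ρ) ^ (n + N) / (n + N).factorial) :=
      ((summable_nat_add_iff N).2 hsum.summable).tsum_le_tsum hbound (hsummable.mul_left _)
    _ ≤ Real.exp |μ + σ ^ 2 / 2| * t ^ N * Real.exp (lam * ρ) := by
      rw [tsum_mul_left]; gcongr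
    _ = _ := by ring

theorem IsMertonModel.existsUnique_isImpliedVol (hX : IsMertonModel P X μ α σ lam δ) {k t : ℝ}
    (hk : 0 ≤ k) (ht : 0 < t) : ∃! s : ℝ, IsImpliedVol P X k t s := by
  have hpos := hX.callPrice_pos hk ht
  have hlt := hX.callPrice_lt_one (k := k) ht
  have hst : 0 < √t := Real.sqrt_pos.2 ht
  have hlim : Tendsto (fun v : ℝ => 1 - Real.exp (k / 2 - v ^ 2 / 8)) atTop (𝓝 1) := by
    have h1 : Tendsto (fun v : ℝ => k / 2 - v ^ 2 / 8) atTop atBot :=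
      tendsto_atBot_add_const_left _ _ (tendsto_neg_atTop_atBot.comp
        ((tendsto_pow_atTop two_ne_zero).atTop_div_const (by norm_num)))
    simpa using (Real.tendsto_exp_atBot.comp h1).const_sub 1
  obtain ⟨V, hV, hV0⟩ := ((hlim.eventually (lt_mem_nhds hlt)).and
    (eventually_ge_atTop 0)).exists
  have hVc : callPrice P X k t ≤ bsCall k V := hV.le.trans (le_bsCall k V)
  obtain ⟨v, hv, hvc⟩ := intermediate_value_Icc hV0 (continuous_bsCall k).continuousOn
    (show callPrice P X k t ∈ Set.Icc (bsCall k 0) (bsCall k V) from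
      ⟨by rw [bsCall_zero hk]; exact hpos.le, hVc⟩)
  refine ⟨v / √t, ⟨div_nonneg hv.1 hst.le, by rw [div_mul_cancel₀ _ hst.ne', hvc]⟩, ?_⟩
  rintro s ⟨hs0, hs⟩
  rw [eq_div_iff hst.ne']
  exact (strictMonoOn_bsCall k).injOn (Set.mem_Ici.2 (by positivity)) hv.1 (hs.trans hvc.symm)

theorem IsMertonModel.isImpliedVol_impliedVol (hX : IsMertonModel P X μ α σ lam δ) {k t : ℝ}
    (hk : 0 ≤ k) (ht : 0 < t) : IsImpliedVol P X k t (impliedVol P X k t) := by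
  obtain ⟨s, hs, huniq⟩ := hX.existsUnique_isImpliedVol hk ht
  have : {s | IsImpliedVol P X k t s} = {s} :=
    Set.eq_singleton_iff_unique_mem.2 ⟨hs, huniq⟩
  rw [impliedVol, this, csInf_singleton]
  exact hs

/-- A bracketing of the call price by Black-Scholes prices gives the asymptotics of the
implied volatility. -/
theorem IsMertonModel.tendsto_impliedVol_div (hX : IsMertonModel P X μ α σ lam δ) {ι : Type*}
    {l : Filter ι} {κ t g : ι → ℝ} (hκ : ∀ i, 0 ≤ κ i) (ht : ∀ i, 0 < t i)
    (hg : ∀ᶠ i in l, 0 < g i)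
    (h : ∀ ε : ℝ, 0 < ε → ε < 1 → ∀ᶠ i in l,
      bsCall (κ i) ((1 - ε) * (g i * √(t i))) ≤ callPrice P X (κ i) (t i) ∧
      callPrice P X (κ i) (t i) ≤ bsCall (κ i) ((1 + ε) * (g i * √(t i)))) :
    Tendsto (fun i => impliedVol P X (κ i) (t i) / g i) l (𝓝 1) := by
  rw [Metric.tendsto_nhds]
  intro ε₀ hε₀
  obtain ⟨ε, hε, hε1⟩ : ∃ ε, 0 < ε ∧ ε < min 1 ε₀ := exists_between (lt_min one_pos hε₀)
  filter_upwards [hg, h ε hε (hε1.trans_le (min_le_left _ _))] with i hgi hi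
  have h1 := hε1.trans_le (min_le_left _ _)
  have h2 := hε1.trans_le (min_le_right _ _)
  have hst : 0 < √(t i) := Real.sqrt_pos.2 (ht i)
  obtain ⟨hs0, hs⟩ := hX.isImpliedVol_impliedVol (hκ i) (ht i)
  rw [← hs] at hi
  have hmono := strictMonoOn_bsCall (κ i)
  have hm1 := (hmono.le_iff_le (Set.mem_Ici.2 (mul_nonneg (by linarith) (by positivity)))
    (Set.mem_Ici.2 (by positivity))).1 hi.1
  have hm2 := (hmono.le_iff_le (Set.mem_Ici.2 (by positivity))
    (Set.mem_Ici.2 (by positivity))).1 hi.2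
  rw [← mul_assoc] at hm1 hm2
  have hm1' := le_of_mul_le_mul_right hm1 hst
  have hm2' := le_of_mul_le_mul_right hm2 hst
  rw [Real.dist_eq, abs_lt]
  have e1 : 1 - ε ≤ impliedVol P X (κ i) (t i) / g i := (le_div_iff₀ hgi).2 hm1'
  have e2 : impliedVol P X (κ i) (t i) / g i ≤ 1 + ε := (div_le_iff₀ hgi).2 hm2'
  constructor <;> linarith

end Model

/-! ### Small strikes: `κ ≤ σ kbar1 t`. -/

theorem abs_exp_sub_one_le_mul_exp (x : ℝ) : |Real.exp x - 1| ≤ |x| * Real.exp |x| := by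
  have h1 : Real.exp x - 1 ≤ x * Real.exp x := by
    have h2 := Real.add_one_le_exp (-x)
    have h3 : Real.exp (-x) * Real.exp x = 1 := by rw [← Real.exp_add]; simp
    nlinarith [Real.exp_pos x]
  have h2 : x * Real.exp x ≤ |x| * Real.exp |x| := by
    have := le_abs_self x
    gcongr
  have h3 : |x| ≤ |x| * Real.exp |x| :=
    le_mul_of_one_le_right (abs_nonneg _) (Real.one_le_exp (abs_nonneg _))
  have h4 := Real.add_one_le_exp x
  have h5 := neg_abs_le x
  rw [abs_le]
  constructor <;> linarith

theorem abs_exp_mul_sub_one_le (b : ℝ) {t : ℝ} (ht : 0 ≤ t) (ht1 : t ≤ 1) :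
    |Real.exp (b * t) - 1| ≤ |b| * Real.exp |b| * t := by
  refine (abs_exp_sub_one_le_mul_exp _).trans ?_
  rw [abs_mul, abs_of_nonneg ht, mul_right_comm]
  gcongr
  exact mul_le_of_le_one_right (abs_nonneg _) ht1

theorem jumpWeight_zero (lam t : ℝ) : jumpWeight lam t 0 = Real.exp (-(lam * t)) := by
  simp [jumpWeight]

theorem abs_bsCall_sub_le (k k' v : ℝ) :
    |bsCall k v - bsCall k' v| ≤ |Real.exp k - Real.exp k'| := by
  have h1 := bsCall_le_bsCall_add k k' v
  have h2 := bsCall_le_bsCall_add k' k v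
  rw [abs_sub_comm] at h2
  rw [abs_le]
  constructor <;> linarith

theorem tendsto_log_one_div_atTop {ι : Type*} {l : Filter ι} {t : ι → ℝ} (ht : ∀ i, 0 < t i)
    (ht0 : Tendsto t l (𝓝 0)) : Tendsto (fun i => Real.log (1 / t i)) l atTop := by
  have h1 : Tendsto t l (𝓝[>] 0) :=
    tendsto_nhdsWithin_iff.2 ⟨ht0, Eventually.of_forall ht⟩
  have h2 := Real.tendsto_log_nhdsGT_zero.comp h1
  refine (tendsto_neg_atBot_atTop.comp h2).congr fun i => ?_
  simp

theorem tendsto_mul_log_one_div {ι : Type*} {l : Filter ι} {t : ι → ℝ}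
    (ht0 : Tendsto t l (𝓝 0)) : Tendsto (fun i => t i * Real.log (1 / t i)) l (𝓝 0) := by
  have := ((Real.continuous_mul_log.tendsto 0).comp ht0).neg
  simp only [zero_mul, neg_zero] at this
  refine this.congr fun i => ?_
  simp

theorem eventually_le_exp_mul {ι : Type*} {l : Filter ι} {u : ι → ℝ} (hu : Tendsto u l atTop)
    (K : ℝ) {a : ℝ} (ha : 0 < a) : ∀ᶠ i in l, K ≤ Real.exp (a * u i) :=
  (Real.tendsto_exp_atTop.comp (hu.const_mul_atTop ha)).eventually_ge_atTop K

/-- For strikes beyond the case threshold `(1 - ε / 2) ^ 4`, this leaves a relative surplus `ε ^ 2 /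
2` in the exponent at volatility `(1 - ε) v`. -/
theorem one_add_sq_half_mul_le {ε : ℝ} (hε : 0 ≤ ε) (hε1 : ε ≤ 1) :
    (1 + ε ^ 2 / 2) * (1 - ε) ^ 2 ≤ (1 - ε / 2) ^ 4 := by
  have h : (1 - ε / 2) ^ 4 - (1 + ε ^ 2 / 2) * (1 - ε) ^ 2 =
      ε ^ 3 / 2 * (1 - ε) + ε ^ 4 / 16 := by ring
  have : 0 ≤ ε ^ 3 / 2 * (1 - ε) := mul_nonneg (by positivity) (by linarith)
  have : 0 ≤ ε ^ 4 / 16 := by positivity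
  linarith

theorem one_le_one_sub_half_mul {ε : ℝ} (hε : 0 ≤ ε) (hε1 : ε ≤ 1) :
    1 ≤ (1 - ε / 2) * (1 + ε / 2) ^ 2 := by
  have h : (1 - ε / 2) * (1 + ε / 2) ^ 2 - 1 = ε / 2 * (1 - ε / 2 - ε ^ 2 / 4) := by ring
  have : 0 ≤ ε / 2 * (1 - ε / 2 - ε ^ 2 / 4) := mul_nonneg (by positivity) (by nlinarith)
  linarith

section Model

variable {Ω : Type*} [MeasurableSpace Ω] {P : Measure Ω} [IsProbabilityMeasure P]
  {X : ℝ → Ω → ℝ} {μ α σ lam δ : ℝ}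

-- The no-jump call is a Black-Scholes call with forward `exp (b t)`. The discrepancies in forward,
-- weight and strike are each `O(t)`; moving the strike costs the factor `exp k`.
omit [IsProbabilityMeasure P] in
theorem IsMertonModel.abs_zero_jump_sub_le (hX : IsMertonModel P X μ α σ lam δ) :
    ∃ C : ℝ, 0 < C ∧ ∀ k t : ℝ, 0 ≤ k → 0 < t → t ≤ 1 →
      |jumpWeight lam t 0 * gaussCall (μ * t + (0 : ℕ) * α) √(σ ^ 2 * t + (0 : ℕ) * δ ^ 2) k -
        bsCall k (σ * √t)| ≤ C * Real.exp k * t := by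
  set b := μ + σ ^ 2 / 2
  refine ⟨|b - lam| * Real.exp |b - lam| + |-b| * Real.exp |-b| + 1, by positivity,
    fun k t hk ht ht1 => ?_⟩
  have hσ := hX.sigma_pos
  have hw : √(σ ^ 2 * t + (0 : ℕ) * δ ^ 2) = σ * √t := by
    rw [Nat.cast_zero, zero_mul, add_zero, Real.sqrt_mul (by positivity), Real.sqrt_sq hσ.le]
  have hm : μ * t + (0 : ℕ) * α + (σ * √t) ^ 2 / 2 = b * t := by
    rw [mul_pow, Real.sq_sqrt ht.le]; push_cast; ring
  rw [hw, gaussCall_eq_bsCall, hm, jumpWeight_zero, ← mul_assoc, ← Real.exp_add]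
  have he : -(lam * t) + b * t = (b - lam) * t := by ring
  rw [he]
  set B := bsCall (k - b * t) (σ * √t)
  have h1 := abs_exp_mul_sub_one_le (b - lam) ht.le ht1
  have h2 : |B - bsCall k (σ * √t)| ≤ Real.exp k * (|-b| * Real.exp |-b| * t) := by
    refine (abs_bsCall_sub_le _ _ _).trans ?_
    have : Real.exp (k - b * t) - Real.exp k = Real.exp k * (Real.exp (-b * t) - 1) := by
      rw [mul_sub, ← Real.exp_add, mul_one]; ring_nf
    rw [this, abs_mul, abs_of_pos (Real.exp_pos k)]
    gcongr
    exact abs_exp_mul_sub_one_le (-b) ht.le ht1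
  have h3 : |B| ≤ 1 := by
    rw [abs_of_nonneg (bsCall_nonneg _ _)]; exact bsCall_le_one _ _
  have h4 := Real.one_le_exp hk
  calc |Real.exp ((b - lam) * t) * B - bsCall k (σ * √t)|
      = |(Real.exp ((b - lam) * t) - 1) * B + (B - bsCall k (σ * √t))| := by ring_nf
    _ ≤ |Real.exp ((b - lam) * t) - 1| * |B| + |B - bsCall k (σ * √t)| := by
      rw [← abs_mul]; exact abs_add_le _ _
    _ ≤ (|b - lam| * Real.exp |b - lam| * t) * 1 + Real.exp k * (|-b| * Real.exp |-b| * t) := by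
      gcongr
    _ ≤ (|b - lam| * Real.exp |b - lam| * t) * Real.exp k +
        Real.exp k * (|-b| * Real.exp |-b| * t) + Real.exp k * t := by
      have : 0 ≤ Real.exp k * t := by positivity
      have : (|b - lam| * Real.exp |b - lam| * t) * 1 ≤
        (|b - lam| * Real.exp |b - lam| * t) * Real.exp k := by gcongr
      linarith
    _ = _ := by ring

/-- All terms with at least one jump together contribute `O(t)`. -/
theorem IsMertonModel.abs_callPrice_sub_le (hX : IsMertonModel P X μ α σ lam δ) :
    ∃ C : ℝ, 0 < C ∧ ∀ k t : ℝ, 0 ≤ k → 0 < t → t ≤ 1 →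
      |callPrice P X k t - bsCall k (σ * √t)| ≤ C * Real.exp k * t := by
  obtain ⟨C, hC, h⟩ := hX.abs_zero_jump_sub_le
  obtain ⟨D, hD, h'⟩ := hX.callPrice_le_sum_add
  refine ⟨C + D, by positivity, fun k t hk ht ht1 => ?_⟩
  have h1 := abs_le.1 (h k t hk ht ht1)
  have h2 := h' 1 k t ht ht1
  rw [Finset.sum_range_one, pow_one] at h2
  have h3 := hX.jumpWeight_mul_le_callPrice ht k 0
  have h4 : D * t * 1 ≤ D * t * Real.exp k := by
    gcongr; exact Real.one_le_exp hk
  have h5 : 0 ≤ D * t * Real.exp k := by positivity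
  rw [abs_le]
  constructor <;> linarith

/-- Keep only the `n`-jump term: its weight is at least a constant times `t ^ n`, its variance at
least `n δ²`, and `A` absorbs the drift and the unit shifts. -/
theorem IsMertonModel.le_callPrice_of_jumps (hX : IsMertonModel P X μ α σ lam δ) {n : ℕ}
    (hn : 1 ≤ n) : ∃ A B : ℝ, 0 < A ∧ 0 < B ∧ ∀ k t : ℝ, 0 ≤ k → 0 < t → t ≤ 1 →
      B * t ^ n * Real.exp (-((k + A) ^ 2 / (2 * n * δ ^ 2))) ≤ callPrice P X k t := by
  have hn0 : (0:ℝ) < n := by exact_mod_cast hn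
  have hδ := hX.delta_pos
  have hl := hX.lam_pos
  have hw0 : 0 < √n * δ := by positivity
  refine ⟨1 + |μ| + n * |α| + √n * δ, Real.exp (-lam) * lam ^ n / n.factorial * (1 / 3),
    by positivity, by positivity, fun k t hk ht ht1 => ?_⟩
  refine le_trans ?_ (hX.jumpWeight_mul_le_callPrice ht k n)
  have hw : √n * δ ≤ √(σ ^ 2 * t + n * δ ^ 2) := by
    apply Real.le_sqrt_of_sq_le
    rw [mul_pow, Real.sq_sqrt hn0.le]
    have : 0 ≤ σ ^ 2 * t := by positivity
    linarith
  have hg := le_gaussCall hk (μ * t + n * α) (hw0.trans_le hw)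
  have hp : Real.exp (-lam) * lam ^ n / n.factorial * t ^ n ≤ jumpWeight lam t n := by
    unfold jumpWeight
    rw [mul_pow, ← mul_assoc, mul_div_right_comm _ (t ^ n)]
    gcongr
    nlinarith
  have habs : |k + 1 - (μ * t + n * α)| ≤ k + (1 + |μ| + n * |α|) := by
    have h1 : |μ * t| ≤ |μ| := by
      rw [abs_mul, abs_of_pos ht]; exact mul_le_of_le_one_right (abs_nonneg _) ht1
    have h2 : |n * α| = n * |α| := by rw [abs_mul, abs_of_pos hn0]
    have h3 := abs_le.1 h1
    have h4 := abs_le.1 h2.le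
    rw [abs_le]
    constructor <;> linarith
  have hsq : (|k + 1 - (μ * t + n * α)| / √(σ ^ 2 * t + n * δ ^ 2) + 1) ^ 2 / 2 ≤
      (k + (1 + |μ| + n * |α| + √n * δ)) ^ 2 / (2 * n * δ ^ 2) := by
    have h1 : |k + 1 - (μ * t + n * α)| / √(σ ^ 2 * t + n * δ ^ 2) + 1 ≤
        (k + (1 + |μ| + n * |α| + √n * δ)) / (√n * δ) := by
      have h2 : |k + 1 - (μ * t + n * α)| / √(σ ^ 2 * t + n * δ ^ 2) ≤
        (k + (1 + |μ| + n * |α|)) / (√n * δ) := by gcongr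
      refine (add_le_add_left h2 1).trans (le_of_eq ?_)
      field_simp
      ring
    calc _ ≤ ((k + (1 + |μ| + n * |α| + √n * δ)) / (√n * δ)) ^ 2 / 2 := by gcongr
      _ = _ := by
        rw [div_pow, mul_pow, Real.sq_sqrt hn0.le]; field_simp
  calc _ = (Real.exp (-lam) * lam ^ n / n.factorial * t ^ n) * (1 / 3 *
        Real.exp (-((k + (1 + |μ| + n * |α| + √n * δ)) ^ 2 / (2 * n * δ ^ 2)))) := by ring
    _ ≤ _ := by
      gcongr
      · exact jumpWeight_nonneg hl.le ht.le n
      · refine le_trans ?_ hg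
        gcongr

set_option maxHeartbeats 800000 in
theorem IsMertonModel.tendsto_impliedVol_of_le_kbar1 (hX : IsMertonModel P X μ α σ lam δ)
    {ι : Type*} {l : Filter ι} {κ t : ι → ℝ} (hκ : ∀ i, 0 ≤ κ i) (ht : ∀ i, 0 < t i)
    (ht0 : Tendsto t l (𝓝 0)) (hle : ∀ᶠ i in l, κ i ≤ σ * kbar1 (t i)) :
    Tendsto (fun i => impliedVol P X (κ i) (t i) / σ) l (𝓝 1) := by
  have hσ := hX.sigma_pos
  have hδ := hX.delta_pos
  refine hX.tendsto_impliedVol_div (g := fun _ => σ) hκ ht (Eventually.of_forall fun _ => hσ)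
    fun ε hε hε1 => ?_
  obtain ⟨C, hC, hcall⟩ := hX.abs_callPrice_sub_le
  obtain ⟨A, B, hA, hB, hjump⟩ := hX.le_callPrice_of_jumps le_rfl
  have hℓ := tendsto_log_one_div_atTop ht ht0
  have htl : Tendsto (fun i => t i * Real.log (1 / t i)) l (𝓝 0) :=
    tendsto_mul_log_one_div ht0
  set c₁ := B * Real.exp (-((1 + A) ^ 2 / (2 * (1:ℕ) * δ ^ 2))) with hc₁
  have hc₁0 : 0 < c₁ := by positivity
  filter_upwards [hle, ht0.eventually (gt_mem_nhds one_pos), hℓ.eventually_ge_atTop 0,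
    ht0.eventually (gt_mem_nhds (show (0:ℝ) < 1 / σ ^ 2 by positivity)),
    htl.eventually (gt_mem_nhds (show (0:ℝ) < 1 / σ ^ 2 by positivity)),
    eventually_le_exp_mul hℓ (C * Real.exp 1 * (6 / (ε * σ)) * Real.exp (1 / 2))
      (show 0 < ε / 4 by positivity),
    eventually_le_exp_mul hℓ (σ * Real.exp (1 / 2) / c₁)
      (show 0 < ε ^ 2 / 4 by positivity)] with i hlei ht1 hℓ0 htσ htlσ hK1 hK2
  have hti := ht i
  have hκi := hκ i
  set k := κ i
  set s := t i
  set ℓ := Real.log (1 / s) with hℓdef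
  have hs : s = Real.exp (-ℓ) := by rw [hℓdef, Real.log_div one_ne_zero hti.ne']; simp [Real.exp_log hti]
  have hss : √s = Real.exp (-ℓ / 2) := by
    rw [hs, Real.exp_half (-ℓ)]
  set v := σ * √s with hv
  have hv0 : 0 < v := mul_pos hσ (Real.sqrt_pos.2 hti)
  have hv2 : v ^ 2 = σ ^ 2 * s := by rw [hv, mul_pow, Real.sq_sqrt hti.le]
  have hv1 : v ^ 2 ≤ 1 := by
    rw [hv2, mul_comm]; exact ((lt_div_iff₀ (by positivity)).1 htσ).le
  have hkb : kbar1 s ^ 2 = s * ℓ := Real.sq_sqrt (mul_nonneg hti.le hℓ0)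
  have hk2 : k ^ 2 ≤ v ^ 2 * ℓ := by
    calc k ^ 2 ≤ (σ * kbar1 s) ^ 2 := by gcongr
      _ = _ := by rw [mul_pow, hkb, hv2]; ring
  have hk1 : k ≤ 1 := by
    have h1 : v ^ 2 * ℓ ≤ 1 := by
      have := ((lt_div_iff₀ (show 0 < σ ^ 2 by positivity)).1 htlσ).le
      rw [hv2]; linarith
    nlinarith
  have hcalli := abs_le.1 (hcall k s hκi hti ht1.le)
  have hCk : C * Real.exp k * s ≤ C * Real.exp 1 * s := by gcongr
  -- As `v` is of order `exp (-ℓ / 2)`, the right side is of order at least `s ^ (1 - ε / 4)`, which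
  -- beats the `O(s)` error of the Black-Scholes approximation.
  have hgap : ∀ E : ℝ, E ≤ (1 / 2 - ε / 4) * ℓ →
      C * Real.exp 1 * s ≤ ε / 2 * v / 3 * Real.exp (-E - 1 / 2) := by
    intro E hE
    have h1 : Real.exp (-((1 / 2 - ε / 4) * ℓ) - 1 / 2) ≤ Real.exp (-E - 1 / 2) := by
      gcongr
    refine le_trans ?_ (mul_le_mul_of_nonneg_left h1 (by positivity))
    have h2 : C * Real.exp 1 ≤
        ε * σ / 6 * Real.exp (-(1 / 2)) * Real.exp (ε / 4 * ℓ) := by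
      refine le_trans (le_of_eq ?_) (mul_le_mul_of_nonneg_left hK1 (by positivity))
      have : Real.exp (-(1 / 2)) * Real.exp (1 / 2) = 1 := by rw [← Real.exp_add]; simp
      field_simp
      linear_combination -this
    calc C * Real.exp 1 * s ≤ ε * σ / 6 * Real.exp (-(1 / 2)) * Real.exp (ε / 4 * ℓ) * s := by
          gcongr
      _ = ε * σ / 6 * (Real.exp (-(1 / 2)) * Real.exp (ε / 4 * ℓ) * s) := by ring
      _ = ε * σ / 6 * (√s * Real.exp (-((1 / 2 - ε / 4) * ℓ) - 1 / 2)) := by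
          rw [hss, hs, ← Real.exp_add, ← Real.exp_add, ← Real.exp_add]; ring_nf
      _ = _ := by rw [hv]; ring
  have hdiv : ∀ a : ℝ, 0 < a → k ^ 2 / (2 * (a * v) ^ 2) = k ^ 2 / v ^ 2 / (2 * a ^ 2) := by
    intro a ha; rw [mul_pow]; field_simp
  have hkv : k ^ 2 / v ^ 2 ≤ ℓ := by rw [div_le_iff₀ (by positivity)]; linarith
  constructor
  · have h1e : 0 < 1 - ε := by linarith
    have h1e2 : 0 < 1 - ε / 2 := by linarith
    -- Away from the critical strike the decrement of the Black-Scholes price exceeds the error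
    -- `O(s)`. Near it that may fail, but the price at `(1 - ε) v` is then at most of order `s ^ (1
    -- + ε² / 4)`, below the one-jump contribution `c₁ * s`.
    by_cases hcase : k ^ 2 / v ^ 2 ≤ (1 - ε / 2) ^ 4 * ℓ
    · have hg := le_bsCall_sub hκi (mul_pos h1e2 hv0)
        (show (1 - ε / 2) * v < v by nlinarith)
      have hm : bsCall k ((1 - ε) * v) ≤ bsCall k ((1 - ε / 2) * v) :=
        (strictMonoOn_bsCall k).monotoneOn (Set.mem_Ici.2 (by positivity))
          (Set.mem_Ici.2 (by positivity)) (by gcongr; linarith)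
      rw [hdiv _ h1e2] at hg
      have hE : k ^ 2 / v ^ 2 / (2 * (1 - ε / 2) ^ 2) ≤ (1 / 2 - ε / 4) * ℓ := by
        rw [div_le_iff₀ (by positivity)]
        refine hcase.trans ?_
        have : (1 - ε / 2) ^ 4 ≤ (1 - ε / 2) * (1 - ε / 2) ^ 2 := by
          have : (1 - ε / 2) ^ 4 = (1 - ε / 2) * (1 - ε / 2) ^ 2 * (1 - ε / 2) := by ring
          rw [this]
          exact mul_le_of_le_one_right (by positivity) (by linarith)
        refine (mul_le_mul_of_nonneg_right this hℓ0).trans (le_of_eq ?_)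
        ring
      have h2 := hgap _ hE
      have h3 : Real.exp (-(k ^ 2 / v ^ 2 / (2 * (1 - ε / 2) ^ 2)) - 1 / 2) ≤
          Real.exp (-(k ^ 2 / v ^ 2 / (2 * (1 - ε / 2) ^ 2)) - v ^ 2 / 8) := by
        apply Real.exp_le_exp.2; linarith
      have h4 := mul_le_mul_of_nonneg_left h3 (show 0 ≤ ε / 2 * v / 3 by positivity)
      have h5 : v - (1 - ε / 2) * v = ε / 2 * v := by ring
      rw [h5] at hg
      linarith
    · have hup := bsCall_le hκi (mul_pos h1e hv0)
      rw [hdiv _ h1e] at hup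
      have hlo := hjump k s hκi hti ht1.le
      have hlo' : c₁ * s ≤ callPrice P X k s := by
        refine le_trans ?_ hlo
        calc c₁ * s = B * s ^ 1 * Real.exp (-((1 + A) ^ 2 / (2 * (1:ℕ) * δ ^ 2))) := by
              rw [hc₁]; ring
          _ ≤ _ := by gcongr
      refine (hup.trans ?_).trans hlo'
      have h1 : (1 + ε ^ 2 / 2) * ℓ / 2 ≤ k ^ 2 / v ^ 2 / (2 * (1 - ε) ^ 2) := by
        rw [le_div_iff₀ (by positivity)]
        have h2 := one_add_sq_half_mul_le hε.le hε1.le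
        have h4 := mul_le_mul_of_nonneg_right h2 hℓ0
        have h5 := not_le.1 hcase
        linarith
      have h2 : σ * Real.exp (1 / 2) ≤ c₁ * Real.exp (ε ^ 2 / 4 * ℓ) := by
        rw [div_le_iff₀ hc₁0] at hK2; linarith
      calc (1 - ε) * v * Real.exp (k / 2 - k ^ 2 / v ^ 2 / (2 * (1 - ε) ^ 2))
          ≤ 1 * v * Real.exp (1 / 2 - (1 + ε ^ 2 / 2) * ℓ / 2) := by
            gcongr; linarith
        _ = σ * Real.exp (1 / 2) * Real.exp (-ℓ / 2 - (1 + ε ^ 2 / 2) * ℓ / 2) := by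
            rw [hv, hss, one_mul, mul_assoc, mul_assoc, ← Real.exp_add, ← Real.exp_add]; ring_nf
        _ ≤ c₁ * Real.exp (ε ^ 2 / 4 * ℓ) * Real.exp (-ℓ / 2 - (1 + ε ^ 2 / 2) * ℓ / 2) := by
            gcongr
        _ = c₁ * s := by
            rw [hs, mul_assoc, ← Real.exp_add]; ring_nf
  · have hg := le_bsCall_sub hκi (show 0 < (1 + ε / 2) * v by positivity)
      (show (1 + ε / 2) * v < (1 + ε) * v by gcongr; linarith)
    have hm : bsCall k v ≤ bsCall k ((1 + ε / 2) * v) :=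
      (strictMonoOn_bsCall k).monotoneOn (Set.mem_Ici.2 (by positivity))
        (Set.mem_Ici.2 (by positivity)) (by nlinarith)
    rw [hdiv _ (by linarith)] at hg
    have hE : k ^ 2 / v ^ 2 / (2 * (1 + ε / 2) ^ 2) ≤ (1 / 2 - ε / 4) * ℓ := by
      rw [div_le_iff₀ (by positivity)]
      refine hkv.trans ?_
      refine (le_mul_of_one_le_left hℓ0 (one_le_one_sub_half_mul hε.le hε1.le)).trans
        (le_of_eq ?_)
      ring
    have h2 := hgap _ hE
    have h3 : Real.exp (-(k ^ 2 / v ^ 2 / (2 * (1 + ε / 2) ^ 2)) - 1 / 2) ≤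
        Real.exp (-(k ^ 2 / v ^ 2 / (2 * (1 + ε / 2) ^ 2)) - ((1 + ε) * v) ^ 2 / 8) := by
      apply Real.exp_le_exp.2
      have h6 : (1 + ε) ^ 2 ≤ (1 + 1) ^ 2 := by gcongr
      have h7 := mul_le_mul h6 hv1 (sq_nonneg v) (by norm_num)
      rw [mul_pow]; linarith
    have h4 := mul_le_mul_of_nonneg_left h3 (show 0 ≤ ε / 2 * v / 3 by positivity)
    have h5 : (1 + ε) * v - (1 + ε / 2) * v = ε / 2 * v := by ring
    rw [h5] at hg
    linarith

end Model

/-! ### The function `mertonF`. -/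

theorem bddBelow_mertonF_terms (δ a : ℝ) : BddBelow (Set.range fun n : ℕ+ =>
    (((n : ℕ) : ℝ) + a ^ 2 / (2 * ((n : ℕ) : ℝ) * δ ^ 2))) :=
  ⟨0, by rintro _ ⟨n, rfl⟩; positivity⟩

theorem mertonF_le (δ a : ℝ) {n : ℕ} (hn : 1 ≤ n) :
    mertonF δ a ≤ n + a ^ 2 / (2 * n * δ ^ 2) :=
  ciInf_le (bddBelow_mertonF_terms δ a) ⟨n, hn⟩

theorem one_le_mertonF (δ a : ℝ) : 1 ≤ mertonF δ a := by
  refine le_ciInf fun n => ?_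
  have h1 : (1:ℝ) ≤ (n : ℕ) := by exact_mod_cast n.pos
  have h2 : 0 ≤ a ^ 2 / (2 * ((n : ℕ) : ℝ) * δ ^ 2) := by positivity
  linarith

theorem mertonF_zero (δ : ℝ) : mertonF δ 0 = 1 := by
  refine le_antisymm ?_ (one_le_mertonF δ 0)
  simpa using mertonF_le δ 0 le_rfl

/-- Near-minimizers suffice for the asymptotics, so attainment of the infimum is never needed. -/
theorem exists_lt_mertonF_add (δ a : ℝ) {η : ℝ} (hη : 0 < η) :
    ∃ n : ℕ, 1 ≤ n ∧ n + a ^ 2 / (2 * n * δ ^ 2) < mertonF δ a + η := by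
  obtain ⟨n, hn⟩ := exists_lt_of_ciInf_lt (lt_add_of_pos_right (mertonF δ a) hη)
  exact ⟨n, n.pos, hn⟩

/-- Every term is Lipschitz in `a²` with constant at most `1 / (2 δ²)`, because `n ≥ 1`; the infimum
inherits this. -/
theorem mertonF_le_add {δ : ℝ} (hδ : 0 < δ) (a b : ℝ) :
    mertonF δ a ≤ mertonF δ b + |a ^ 2 - b ^ 2| / (2 * δ ^ 2) := by
  rw [← sub_le_iff_le_add]
  refine le_ciInf fun n => ?_
  have h1 : (1:ℝ) ≤ (n : ℕ) := by exact_mod_cast n.pos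
  have h2 : mertonF δ a ≤ ((n : ℕ) : ℝ) + a ^ 2 / (2 * ((n : ℕ) : ℝ) * δ ^ 2) :=
    mertonF_le δ a n.pos
  have h3 : a ^ 2 / (2 * ((n : ℕ) : ℝ) * δ ^ 2) - b ^ 2 / (2 * ((n : ℕ) : ℝ) * δ ^ 2) ≤
      |a ^ 2 - b ^ 2| / (2 * δ ^ 2) := by
    rw [← sub_div]
    refine (div_le_div_of_nonneg_right (le_abs_self _) (by positivity)).trans ?_
    gcongr
    linarith
  linarith

theorem continuous_mertonF {δ : ℝ} (hδ : 0 < δ) : Continuous (mertonF δ) := by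
  rw [continuous_iff_continuousAt]
  intro a
  rw [ContinuousAt, tendsto_iff_dist_tendsto_zero]
  have h : Tendsto (fun b : ℝ => |b ^ 2 - a ^ 2| / (2 * δ ^ 2)) (𝓝 a) (𝓝 0) := by
    have : Continuous fun b : ℝ => |b ^ 2 - a ^ 2| / (2 * δ ^ 2) := by fun_prop
    simpa using this.tendsto a
  refine squeeze_zero (fun _ => dist_nonneg) (fun b => ?_) h
  have h1 := mertonF_le_add hδ a b
  have h2 := mertonF_le_add hδ b a
  rw [abs_sub_comm] at h1
  rw [Real.dist_eq, abs_le]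
  constructor <;> linarith

/-! ### Strikes reached by a bounded number of jumps. -/

theorem exp_neg_log_one_div {t : ℝ} (ht : 0 < t) : Real.exp (-Real.log (1 / t)) = t := by
  rw [one_div, Real.log_inv, neg_neg, Real.exp_log ht]

theorem sqrt_eq_exp_neg_half {t : ℝ} (ht : 0 < t) : √t = Real.exp (-(Real.log (1 / t) / 2)) := by
  conv_lhs => rw [← exp_neg_log_one_div ht]
  rw [← Real.exp_half, neg_div]

/-- Comparison of the scales of the model when `σ √(t log (1 / t)) ≤ κ` and `κ / √(log (1 / t))`
has a limit. -/
theorem scale_bounds {σ : ℝ} (hσ : 0 < σ) (δ : ℝ) {ι : Type*} {l : Filter ι} {κ t : ι → ℝ}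
    (hκ : ∀ i, 0 ≤ κ i) (ht : ∀ i, 0 < t i) (ht0 : Tendsto t l (𝓝 0))
    (hge : ∀ᶠ i in l, σ * kbar1 (t i) ≤ κ i) {a : ℝ} (ha : 0 ≤ a)
    (hlim : Tendsto (fun i => κ i / kbar2 (t i)) l (𝓝 a)) {ℓ L : ι → ℝ}
    (hℓdef : ℓ = fun i => Real.log (1 / t i)) (hLdef : L = fun i => Real.log (κ i / t i)) :
    Tendsto (fun i => κ i / ℓ i) l (𝓝 0) ∧
    (∀ A : ℝ, Tendsto (fun i => (κ i + A) ^ 2 / ℓ i) l (𝓝 (a ^ 2))) ∧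
    (∀ᶠ i in l, ℓ i / 2 ≤ κ i ^ 2 / (2 * σ ^ 2 * t i)) ∧
    (∀ᶠ i in l, 0 < κ i) ∧
    (∀ᶠ i in l, L i = Real.log (κ i) + ℓ i) ∧
    (∀ᶠ i in l, ℓ i / 2 ≤ L i) ∧
    (∀ᶠ i in l, L i ≤ ℓ i + κ i) ∧
    (∀ᶠ i in l, 0 ≤ (mertonF δ a - 1) * (L i - ℓ i) ∧
      ℓ i / 2 + (mertonF δ a - 1) * L i ≤
        κ i ^ 2 / (2 * σ ^ 2 * t i)) := by
  set f := mertonF δ a with hf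
  have hf1 : 1 ≤ f := one_le_mertonF δ a
  have hℓ : Tendsto ℓ l atTop := hℓdef ▸ tendsto_log_one_div_atTop ht ht0
  have htl : Tendsto (fun i => t i * ℓ i) l (𝓝 0) := by
    simpa only [hℓdef] using tendsto_mul_log_one_div ht0
  have hsqℓ : Tendsto (fun i => √(ℓ i)) l atTop := Real.tendsto_sqrt_atTop.comp hℓ
  have hκℓ : Tendsto (fun i => κ i / ℓ i) l (𝓝 0) := by
    have h1 := hlim.mul hsqℓ.inv_tendsto_atTop
    rw [mul_zero] at h1
    refine h1.congr' ?_
    filter_upwards [hℓ.eventually_gt_atTop 0] with i hi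
    simp only [kbar2, Pi.inv_apply, hℓdef] at hi ⊢
    rw [← div_eq_mul_inv, div_div, Real.mul_self_sqrt hi.le]
  have hκ2 : ∀ A : ℝ, Tendsto (fun i => (κ i + A) ^ 2 / ℓ i) l (𝓝 (a ^ 2)) := by
    intro A
    have h1 := (hlim.add (hsqℓ.inv_tendsto_atTop.const_mul A)).pow 2
    rw [mul_zero, add_zero] at h1
    refine h1.congr' ?_
    filter_upwards [hℓ.eventually_gt_atTop 0] with i hi
    simp only [kbar2, Pi.inv_apply, hℓdef] at hi ⊢
    rw [← div_eq_mul_inv, ← add_div, div_pow, Real.sq_sqrt hi.le]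
  have hsmall' : ∀ D η : ℝ, 0 < η → ∀ᶠ i in l, D * κ i ≤ η * ℓ i := by
    intro D η hη
    filter_upwards [(hκℓ.const_mul D).eventually (gt_mem_nhds (by simpa using hη)),
      hℓ.eventually_gt_atTop 0] with i hi hi0
    rw [← mul_div_assoc, div_lt_iff₀ hi0] at hi
    exact hi.le
  have hR : ∀ᶠ i in l, ℓ i / 2 ≤ κ i ^ 2 / (2 * σ ^ 2 * t i) := by
    filter_upwards [hge, hℓ.eventually_ge_atTop 0] with i hi hi0
    have hti := ht i
    rw [le_div_iff₀ (by positivity)]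
    have h1 : (σ * kbar1 (t i)) ^ 2 ≤ κ i ^ 2 := by
      have : 0 ≤ kbar1 (t i) := Real.sqrt_nonneg _
      gcongr
    simp only [hℓdef] at hi0 ⊢
    rw [mul_pow, kbar1, Real.sq_sqrt (mul_nonneg hti.le hi0)] at h1
    linarith
  have hκpos : ∀ᶠ i in l, 0 < κ i := by
    filter_upwards [hR, hℓ.eventually_gt_atTop 0] with i hi hi0
    refine lt_of_le_of_ne (hκ i) fun h => ?_
    rw [← h] at hi
    simp at hi
    linarith
  have hLeq : ∀ᶠ i in l, L i = Real.log (κ i) + ℓ i := by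
    filter_upwards [hκpos] with i hi
    simp only [hLdef, hℓdef]
    rw [Real.log_div hi.ne' (ht i).ne', one_div, Real.log_inv]; ring
  -- Although `κ` may tend to `0`, eventually `κ² ≥ t`, so `log κ ≥ -ℓ / 2`.
  have hLℓ : ∀ᶠ i in l, ℓ i / 2 ≤ L i := by
    filter_upwards [hR, hκpos, hLeq, hℓ.eventually_ge_atTop (1 / σ ^ 2)] with i hi hi0 hi2 hi3
    have hti := ht i
    have h1 : t i ≤ κ i ^ 2 := by
      rw [le_div_iff₀ (by positivity)] at hi
      have : 1 ≤ ℓ i * σ ^ 2 := (div_le_iff₀ (by positivity)).1 hi3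
      nlinarith
    have h2 := Real.log_le_log hti h1
    rw [Real.log_pow] at h2
    have h3 : ℓ i = -Real.log (t i) := by simp [hℓdef]
    push_cast at h2
    linarith
  have hLκ : ∀ᶠ i in l, L i ≤ ℓ i + κ i := by
    filter_upwards [hLeq, hκpos] with i hi hi0
    have := Real.log_le_sub_one_of_pos hi0
    linarith
  -- The target `κ exp (-f L)` equals `exp (-(ℓ + (f - 1) L))`, and the no-jump term is about `exp
  -- (-(ℓ / 2 + κ² / (2 σ² t)))`; the second inequality compares them. If `a = 0` then `f = 1`; if
  -- `a > 0` then `κ → ∞`, whence `L ≥ ℓ`, and `t ℓ → 0` settles the comparison.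
  have hcases : ∀ᶠ i in l, 0 ≤ (f - 1) * (L i - ℓ i) ∧
      ℓ i / 2 + (f - 1) * L i ≤ κ i ^ 2 / (2 * σ ^ 2 * t i) := by
    rcases ha.eq_or_lt with h0 | hpos
    · have : f = 1 := by rw [hf, ← h0, mertonF_zero]
      filter_upwards [hR] with i hi
      rw [this]; simpa using hi
    · have hκ1 : Tendsto κ l atTop := by
        refine (hlim.pos_mul_atTop hpos hsqℓ).congr' ?_
        filter_upwards [hℓ.eventually_gt_atTop 0] with i hi
        simp only [kbar2, hℓdef] at hi ⊢
        exact div_mul_cancel₀ _ (Real.sqrt_pos.2 hi).ne'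
      filter_upwards [hκ1.eventually_ge_atTop 1, hLeq, hLκ, hsmall' 1 1 one_pos,
        htl.eventually (gt_mem_nhds (show (0:ℝ) < 1 / (2 * σ ^ 2 * (1 / 2 + (f - 1) * 2)) by
          have : 0 ≤ f - 1 := by linarith
          positivity))] with i hi hi2 hi3 hi4 hi5
      have hti := ht i
      have hf0 : 0 ≤ f - 1 := by linarith
      constructor
      · have := Real.log_nonneg hi
        exact mul_nonneg hf0 (by linarith)
      · rw [le_div_iff₀ (by positivity)]
        rw [lt_div_iff₀ (by positivity)] at hi5
        have h1 : L i ≤ 2 * ℓ i := by linarith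
        have h2 : (f - 1) * L i ≤ (f - 1) * (2 * ℓ i) := by gcongr
        have h3 : (ℓ i / 2 + (f - 1) * L i) * (2 * σ ^ 2 * t i) ≤
            (ℓ i / 2 + (f - 1) * (2 * ℓ i)) * (2 * σ ^ 2 * t i) := by gcongr
        nlinarith
  exact ⟨hκℓ, hκ2, hR, hκpos, hLeq, hLℓ, hLκ, hcases⟩

section Model

variable {Ω : Type*} [MeasurableSpace Ω] {P : Measure Ω} [IsProbabilityMeasure P]
  {X : ℝ → Ω → ℝ} {μ α σ lam δ : ℝ}

-- The factor `√t` in the Black-Scholes bound is kept as `exp (-ℓ / 2)`, since it decides the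
-- comparison at the critical strike. The condition on `k` keeps the strike nonnegative after the
-- drift is removed.
omit [IsProbabilityMeasure P] in
theorem IsMertonModel.zero_jump_le (hX : IsMertonModel P X μ α σ lam δ) :
    ∃ b K D : ℝ, 0 < b ∧ 0 < K ∧ 0 < D ∧ ∀ k t : ℝ, b * t ≤ k → 0 < t → t ≤ 1 →
      jumpWeight lam t 0 * gaussCall (μ * t + (0 : ℕ) * α) √(σ ^ 2 * t + (0 : ℕ) * δ ^ 2) k ≤
        K * Real.exp (-(Real.log (1 / t) / 2) + D * k - k ^ 2 / (2 * σ ^ 2 * t)) := by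
  have hσ := hX.sigma_pos
  have hl := hX.lam_pos
  set b := μ + σ ^ 2 / 2
  refine ⟨|b| + 1, Real.exp |b| * σ * Real.exp (|b| / 2), 1 / 2 + |b| / σ ^ 2, by positivity,
    by positivity, by positivity, fun k t hbt ht ht1 => ?_⟩
  have hk : 0 ≤ k := le_trans (by positivity) hbt
  have hst : 0 < √t := Real.sqrt_pos.2 ht
  have hw : √(σ ^ 2 * t + (0 : ℕ) * δ ^ 2) = σ * √t := by
    rw [Nat.cast_zero, zero_mul, add_zero, Real.sqrt_mul (by positivity), Real.sqrt_sq hσ.le]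
  have hv2 : (σ * √t) ^ 2 = σ ^ 2 * t := by rw [mul_pow, Real.sq_sqrt ht.le]
  have hm : μ * t + (0 : ℕ) * α + (σ * √t) ^ 2 / 2 = b * t := by
    rw [hv2]; push_cast; ring
  have hb1 : b * t ≤ |b| * t := by gcongr; exact le_abs_self b
  have hb2 : -(|b| * t) ≤ b * t := by
    rw [← neg_mul]; gcongr; exact neg_abs_le b
  have hbt' : |b| * t ≤ |b| := mul_le_of_le_one_right (abs_nonneg _) ht1
  have hk' : 0 ≤ k - b * t := by linarith
  have hbs := bsCall_le hk' (mul_pos hσ hst)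
  rw [hv2] at hbs
  have hsq : k ^ 2 - 2 * |b| * t * k ≤ (k - b * t) ^ 2 := by
    nlinarith [sq_nonneg (b * t)]
  have hexp : (k - b * t) / 2 - (k - b * t) ^ 2 / (2 * (σ ^ 2 * t)) ≤
      |b| / 2 + ((1 / 2 + |b| / σ ^ 2) * k - k ^ 2 / (2 * σ ^ 2 * t)) := by
    have h1 : (k ^ 2 - 2 * |b| * t * k) / (2 * (σ ^ 2 * t)) ≤
        (k - b * t) ^ 2 / (2 * (σ ^ 2 * t)) := by gcongr
    have h2 : (k ^ 2 - 2 * |b| * t * k) / (2 * (σ ^ 2 * t)) =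
        k ^ 2 / (2 * σ ^ 2 * t) - |b| / σ ^ 2 * k := by field_simp
    linarith
  rw [hw, gaussCall_eq_bsCall, hm, jumpWeight_zero]
  calc Real.exp (-(lam * t)) * (Real.exp (b * t) * bsCall (k - b * t) (σ * √t))
      ≤ 1 * (Real.exp |b| * (σ * √t * Real.exp (|b| / 2 +
        ((1 / 2 + |b| / σ ^ 2) * k - k ^ 2 / (2 * σ ^ 2 * t))))) := by
        have h0 := bsCall_nonneg (k - b * t) (σ * √t)
        gcongr
        · exact Real.exp_le_one_iff.2 (by have := mul_pos hl ht; linarith)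
        · linarith
        · exact hbs.trans (by gcongr)
    _ = _ := by
        rw [sqrt_eq_exp_neg_half ht, one_mul, Real.exp_add (|b| / 2), add_sub_assoc,
          Real.exp_add (-(Real.log (1 / t) / 2))]
        ring

omit [IsProbabilityMeasure P] in
theorem IsMertonModel.jumps_le (hX : IsMertonModel P X μ α σ lam δ) {n : ℕ} (hn : 1 ≤ n) :
    ∃ K D : ℝ, 0 < K ∧ 0 < D ∧ ∀ k t : ℝ, 0 ≤ k → 0 < t → t ≤ 1 →
      jumpWeight lam t n * gaussCall (μ * t + n * α) √(σ ^ 2 * t + n * δ ^ 2) k ≤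
        K * Real.exp (-(n * Real.log (1 / t)) + D * (k + k ^ 2 * t) -
          k ^ 2 / (2 * n * δ ^ 2)) := by
  have hn0 : (0:ℝ) < n := by exact_mod_cast hn
  have hσ := hX.sigma_pos
  have hδ := hX.delta_pos
  have hl := hX.lam_pos
  set M := |μ| + n * |α| with hM
  have hM0 : 0 ≤ M := by positivity
  -- `r * k` is, to leading order, the optimal Chernoff parameter for variance `n δ²`; the diffusion
  -- variance `σ² t` only adds to the error term.
  set r := 1 / (n * δ ^ 2) with hr
  have hr0 : 0 < r := by positivity
  refine ⟨lam ^ n / n.factorial * Real.exp (M + σ ^ 2 + n * δ ^ 2 / 2),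
    1 + M * r + r ^ 2 * σ ^ 2, by positivity, by positivity, fun k t hk ht ht1 => ?_⟩
  have hp : jumpWeight lam t n ≤ lam ^ n / n.factorial * t ^ n := by
    unfold jumpWeight
    rw [mul_pow, mul_div_assoc, mul_div_right_comm]
    refine mul_le_of_le_one_left (by positivity) (Real.exp_le_one_iff.2 ?_)
    have := mul_pos hl ht
    linarith
  have hg := gaussCall_le_exp (show 0 ≤ r * k by positivity) (μ * t + n * α)
    √(σ ^ 2 * t + n * δ ^ 2) k
  rw [Real.sq_sqrt (by positivity)] at hg
  have hm : μ * t + n * α ≤ M := by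
    have h1 : μ * t ≤ |μ| :=
      (mul_le_mul_of_nonneg_right (le_abs_self _) ht.le).trans
        (mul_le_of_le_one_right (abs_nonneg _) ht1)
    have h2 : n * α ≤ n * |α| := by gcongr; exact le_abs_self α
    linarith
  have htn : t ^ n = Real.exp (-(n * Real.log (1 / t))) := by
    conv_lhs => rw [← exp_neg_log_one_div ht, ← Real.exp_nat_mul]
    rw [mul_neg]
  have hexp : -(r * k * k) + (1 + r * k) * (μ * t + n * α) +
      (1 + r * k) ^ 2 * (σ ^ 2 * t + n * δ ^ 2) / 2 ≤
      (M + σ ^ 2 + n * δ ^ 2 / 2) + ((1 + M * r + r ^ 2 * σ ^ 2) * (k + k ^ 2 * t) -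
        k ^ 2 / (2 * n * δ ^ 2)) := by
    have e1 : k ^ 2 / (2 * n * δ ^ 2) = r * k ^ 2 / 2 := by rw [hr]; field_simp
    have e2 : r * (n * δ ^ 2) = 1 := by rw [hr]; field_simp
    have e3 : (1 + r * k) ^ 2 * (n * δ ^ 2) / 2 = n * δ ^ 2 / 2 + k + r * k ^ 2 / 2 := by
      linear_combination (k + r * k ^ 2 / 2) * e2
    have h1 : (1 + r * k) * (μ * t + n * α) ≤ (1 + r * k) * M := by gcongr
    have h2 : (1 + r * k) ^ 2 * (σ ^ 2 * t) / 2 ≤ σ ^ 2 + r ^ 2 * σ ^ 2 * (k ^ 2 * t) := by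
      have h3 : (1 + r * k) ^ 2 ≤ 2 + 2 * (r * k) ^ 2 := by nlinarith [sq_nonneg (1 - r * k)]
      have h4 : (1 + r * k) ^ 2 * (σ ^ 2 * t) ≤ (2 + 2 * (r * k) ^ 2) * (σ ^ 2 * t) := by gcongr
      have h5 : σ ^ 2 * t ≤ σ ^ 2 := mul_le_of_le_one_right (by positivity) ht1
      linarith
    have h6 : 0 ≤ r ^ 2 * σ ^ 2 * k := by positivity
    have h7 : 0 ≤ (1 + M * r) * (k ^ 2 * t) := by positivity
    rw [e1]
    linarith
  calc _ ≤ (lam ^ n / n.factorial * t ^ n) * Real.exp ((M + σ ^ 2 + n * δ ^ 2 / 2) +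
        ((1 + M * r + r ^ 2 * σ ^ 2) * (k + k ^ 2 * t) - k ^ 2 / (2 * n * δ ^ 2))) :=
      mul_le_mul hp (hg.trans (Real.exp_le_exp.2 hexp)) (gaussCall_nonneg _ _ _) (by positivity)
    _ = _ := by
      rw [htn, Real.exp_add, add_sub_assoc, Real.exp_add (-(n * Real.log (1 / t)))]
      ring

set_option maxHeartbeats 800000 in
/-- Asymptotics of the implied volatility when the price is governed by a bounded number of
jumps. -/
theorem IsMertonModel.tendsto_impliedVol_of_tendsto_div_kbar2
    (hX : IsMertonModel P X μ α σ lam δ) {ι : Type*} {l : Filter ι} {κ t : ι → ℝ}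
    (hκ : ∀ i, 0 ≤ κ i) (ht : ∀ i, 0 < t i) (ht0 : Tendsto t l (𝓝 0))
    (hge : ∀ᶠ i in l, σ * kbar1 (t i) ≤ κ i) {a : ℝ} (ha : 0 ≤ a)
    (hlim : Tendsto (fun i => κ i / kbar2 (t i)) l (𝓝 a)) :
    Tendsto (fun i => impliedVol P X (κ i) (t i) /
      (κ i / √(2 * t i * mertonF δ a * Real.log (κ i / t i)))) l (𝓝 1) := by
  have hσ := hX.sigma_pos
  have hδ := hX.delta_pos
  set f := mertonF δ a with hf
  have hf1 : 1 ≤ f := one_le_mertonF δ a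
  set ℓ : ι → ℝ := fun i => Real.log (1 / t i) with hℓdef
  set L : ι → ℝ := fun i => Real.log (κ i / t i) with hLdef
  obtain ⟨hκℓ, hκ2, hR, hκpos, hLeq, hLℓ, hLκ, hcases⟩ :=
    scale_bounds hσ δ hκ ht ht0 hge ha hlim hℓdef hLdef
  rw [← hf] at hcases
  have hℓ : Tendsto ℓ l atTop := tendsto_log_one_div_atTop ht ht0
  have htl : Tendsto (fun i => t i * ℓ i) l (𝓝 0) := tendsto_mul_log_one_div ht0
  have hsmall : ∀ D η : ℝ, 0 < η → ∀ᶠ i in l, D * (κ i + κ i ^ 2 * t i) ≤ η * ℓ i := by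
    intro D η hη
    have h1 : Tendsto (fun i => D * (κ i / ℓ i + (κ i + 0) ^ 2 / ℓ i * t i)) l (𝓝 0) := by
      have := (hκℓ.add ((hκ2 0).mul ht0)).const_mul D
      simpa using this
    filter_upwards [h1.eventually (gt_mem_nhds hη), hℓ.eventually_gt_atTop 0] with i hi hi0
    rw [add_zero] at hi
    have : D * (κ i / ℓ i + κ i ^ 2 / ℓ i * t i) = D * (κ i + κ i ^ 2 * t i) / ℓ i := by ring
    rw [this, div_lt_iff₀ hi0] at hi
    exact hi.le
  have hsmall' : ∀ D η : ℝ, 0 < η → ∀ᶠ i in l, D * κ i ≤ η * ℓ i := by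
    intro D η hη
    filter_upwards [(hκℓ.const_mul D).eventually (gt_mem_nhds (by simpa using hη)),
      hℓ.eventually_gt_atTop 0] with i hi hi0
    rw [← mul_div_assoc, div_lt_iff₀ hi0] at hi
    exact hi.le
  have hκexp : ∀ᶠ i in l, κ i = Real.exp (L i - ℓ i) := by
    filter_upwards [hκpos, hLeq] with i hi hi2
    rw [hi2, add_sub_cancel_right, Real.exp_log hi]
  have hf0 : 0 < f := by linarith
  have hL : Tendsto L l atTop :=
    tendsto_atTop_mono' l hLℓ (hℓ.atTop_div_const two_pos)
  have hq : Tendsto (fun i => f * L i) l atTop := hL.const_mul_atTop hf0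
  have hκq : Tendsto (fun i => κ i / (f * L i)) l (𝓝 0) := by
    have h2 : Tendsto (fun i => 2 * (κ i / ℓ i)) l (𝓝 0) := by simpa using hκℓ.const_mul 2
    refine squeeze_zero' ?_ ?_ h2
    · filter_upwards [hL.eventually_ge_atTop 0] with i hi
      have := hκ i
      positivity
    · filter_upwards [hLℓ, hℓ.eventually_gt_atTop 0] with i hi hi0
      have hκi := hκ i
      have h3 : ℓ i / 2 ≤ f * L i := by nlinarith
      calc κ i / (f * L i) ≤ κ i / (ℓ i / 2) := by gcongr
        _ = _ := by field_simp
  have hlo : ∀ ε : ℝ, 0 < ε →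
      ∀ᶠ i in l, κ i * Real.exp (-((1 + ε) * (f * L i))) ≤ callPrice P X (κ i) (t i) := by
    intro ε hε
    -- Since `f L ≥ ℓ / 2`, the slack `ε f L` is at least `3 η ℓ`: one `η` each for the constant
    -- `B`, the near-optimal `n` and the limit of `(κ + A)² / ℓ`.
    set η := ε / 6 with hη
    have hη0 : 0 < η := by positivity
    obtain ⟨n, hn, hnf⟩ := exists_lt_mertonF_add δ a hη0
    have hn0 : (0:ℝ) < n := by exact_mod_cast hn
    obtain ⟨A, B, hA, hB, hjump⟩ := hX.le_callPrice_of_jumps hn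
    have hAlim := ((hκ2 A).div_const (2 * n * δ ^ 2)).eventually
      (gt_mem_nhds (lt_add_of_pos_right _ hη0))
    filter_upwards [hAlim, hℓ.eventually_gt_atTop 0, eventually_le_exp_mul hℓ (1 / B) hη0,
      hcases, hLℓ, hκexp, ht0.eventually (gt_mem_nhds one_pos)] with i h1 h2 h3 h4 h5 h6 h7
    refine le_trans ?_ (hjump (κ i) (t i) (hκ i) (ht i) h7.le)
    have htn : t i ^ n = Real.exp (-(n * ℓ i)) := by
      conv_lhs => rw [← exp_neg_log_one_div (ht i), ← Real.exp_nat_mul]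
      rw [mul_neg]
    have hB' : Real.exp (-(η * ℓ i)) ≤ B := by
      rw [Real.exp_neg, inv_le_comm₀ (Real.exp_pos _) hB, ← one_div]; exact h3
    have h8 : (κ i + A) ^ 2 / (2 * n * δ ^ 2) ≤ (a ^ 2 / (2 * n * δ ^ 2) + η) * ℓ i := by
      rw [div_right_comm, div_lt_iff₀ h2] at h1; exact h1.le
    calc κ i * Real.exp (-((1 + ε) * (f * L i)))
        = Real.exp (L i - ℓ i - (1 + ε) * (f * L i)) := by
          conv_lhs => rw [h6, ← Real.exp_add, ← sub_eq_add_neg]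
      _ ≤ Real.exp (-(η * ℓ i) + -(n * ℓ i) + -((a ^ 2 / (2 * n * δ ^ 2) + η) * ℓ i)) := by
          apply Real.exp_le_exp.2
          have h9 : (n + a ^ 2 / (2 * n * δ ^ 2)) * ℓ i ≤ (f + η) * ℓ i := by gcongr
          have h10 : ε * (ℓ i / 2) ≤ ε * (f * L i) := by
            gcongr; nlinarith
          have h11 : η * ℓ i * 6 = ε * ℓ i := by rw [hη]; ring
          linarith [h4.1]
      _ = Real.exp (-(η * ℓ i)) * Real.exp (-(n * ℓ i)) *
            Real.exp (-((a ^ 2 / (2 * n * δ ^ 2) + η) * ℓ i)) := by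
          rw [Real.exp_add, Real.exp_add]
      _ ≤ B * t i ^ n * Real.exp (-((κ i + A) ^ 2 / (2 * n * δ ^ 2))) := by
          rw [htn]; gcongr
  have hup : ∀ ε : ℝ, 0 < ε →
      ∀ᶠ i in l, callPrice P X (κ i) (t i) ≤ κ i * Real.exp (-((1 - ε) * (f * L i))) := by
    intro ε hε
    set η := ε / 6 with hη
    have hη0 : 0 < η := by positivity
    set T : ι → ℝ := fun i => κ i * Real.exp (-((1 - ε) * (f * L i))) with hTdef
    have hT : ∀ᶠ i in l, T i = Real.exp (L i - ℓ i - (1 - ε) * (f * L i)) := by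
      filter_upwards [hκexp] with i hi
      simp only [hTdef]
      conv_lhs => rw [hi, ← Real.exp_add, ← sub_eq_add_neg]
    have hmain : ∀ K : ℝ, 0 < K → ∀ᶠ i in l, K * Real.exp (-((f - η) * ℓ i)) ≤ T i := by
      intro K hK
      filter_upwards [hT, eventually_le_exp_mul hℓ K hη0, hLκ, hsmall' (f - 1) η hη0, hLℓ,
        hℓ.eventually_gt_atTop 0] with i h1 h2 h3 h4 h5 h6
      rw [h1]
      calc K * Real.exp (-((f - η) * ℓ i))
          ≤ Real.exp (η * ℓ i) * Real.exp (-((f - η) * ℓ i)) := by gcongr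
        _ = Real.exp (η * ℓ i + -((f - η) * ℓ i)) := by rw [Real.exp_add]
        _ ≤ _ := by
          apply Real.exp_le_exp.2
          have h7 : (f - 1) * (L i - ℓ i) ≤ (f - 1) * κ i := by
            apply mul_le_mul_of_nonneg_left <;> linarith
          have h10 : ε * (ℓ i / 2) ≤ ε * (f * L i) := by
            gcongr; nlinarith
          have h11 : η * ℓ i * 6 = ε * ℓ i := by rw [hη]; ring
          linarith
    obtain ⟨C, hC, hsum⟩ := hX.callPrice_le_sum_add
    -- As `N ≥ f`, the tail `C t ^ N` is negligible. The `N` remaining terms and the tail each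
    -- receive a share `T / (N + 1)`.
    set N := ⌈f⌉₊ + 1 with hN
    have hNf : f ≤ N := by
      rw [hN]; push_cast; linarith [Nat.le_ceil f]
    have htail : ∀ᶠ i in l, C * t i ^ N ≤ T i / (N + 1) := by
      filter_upwards [hmain (C * (N + 1)) (by positivity), hℓ.eventually_ge_atTop 0]
        with i h1 h2
      rw [le_div_iff₀ (by positivity)]
      refine le_trans ?_ h1
      have htn : t i ^ N = Real.exp (-(N * ℓ i)) := by
        conv_lhs => rw [← exp_neg_log_one_div (ht i), ← Real.exp_nat_mul]
        rw [mul_neg]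
      rw [htn, mul_right_comm]
      gcongr
      linarith
    have hterms : ∀ n ∈ Finset.range N, ∀ᶠ i in l, jumpWeight lam (t i) n *
        gaussCall (μ * t i + n * α) √(σ ^ 2 * t i + n * δ ^ 2) (κ i) ≤ T i / (N + 1) := by
      intro n _
      rcases Nat.eq_zero_or_pos n with rfl | hn
      · obtain ⟨b, K, D, hb, hK, hD, hzero⟩ := hX.zero_jump_le
        have hbt : ∀ᶠ i in l, b * t i ≤ κ i := by
          filter_upwards [hR, htl.eventually (gt_mem_nhds
              (show (0:ℝ) < σ ^ 2 by positivity)), hℓ.eventually_ge_atTop (b ^ 2 / σ ^ 2),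
              ht0.eventually (gt_mem_nhds one_pos)] with i h1 h2 h3 h4
          have hti := ht i
          rw [le_div_iff₀ (by positivity)] at h1
          rw [div_le_iff₀ (by positivity)] at h3
          refine abs_le_of_sq_le_sq' ?_ (hκ i) |>.2
          have h5 : t i * t i ≤ t i := by nlinarith
          have h6 : 0 ≤ ℓ i * σ ^ 2 := (sq_nonneg b).trans h3
          calc (b * t i) ^ 2 = b ^ 2 * (t i * t i) := by ring
            _ ≤ (ℓ i * σ ^ 2) * t i := by gcongr
            _ ≤ κ i ^ 2 := by linarith
        filter_upwards [hbt, hT, hcases, hLℓ, hsmall' D η hη0, ht0.eventually (gt_mem_nhds one_pos),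
          eventually_le_exp_mul hℓ (K * (N + 1)) hη0, hℓ.eventually_ge_atTop 0]
          with i h1 h2 h3 h4 h5 h6 h7 h8
        refine (hzero (κ i) (t i) h1 (ht i) h6.le).trans ?_
        rw [le_div_iff₀ (by positivity), mul_right_comm, h2]
        calc _ ≤ Real.exp (η * ℓ i) *
              Real.exp (-(ℓ i / 2) + D * κ i - κ i ^ 2 / (2 * σ ^ 2 * t i)) := by gcongr
          _ = Real.exp (η * ℓ i + (-(ℓ i / 2) + D * κ i - κ i ^ 2 / (2 * σ ^ 2 * t i))) := by
              rw [Real.exp_add]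
          _ ≤ _ := by
              apply Real.exp_le_exp.2
              have h10 : ε * (ℓ i / 2) ≤ ε * (f * L i) := by
                gcongr; nlinarith
              have h11 : η * ℓ i * 6 = ε * ℓ i := by rw [hη]; ring
              have h12 : 0 ≤ η * ℓ i := by positivity
              linarith [h3.2]
      · have hn0 : (0:ℝ) < n := by exact_mod_cast hn
        obtain ⟨K, D, hK, hD, hjumps⟩ := hX.jumps_le hn
        have hlimn := ((hκ2 0).div_const (2 * n * δ ^ 2)).eventually
          (lt_mem_nhds (sub_lt_self _ (half_pos hη0)))
        filter_upwards [hlimn, hsmall D (η / 2) (half_pos hη0), ht0.eventually (gt_mem_nhds one_pos),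
          hmain (K * (N + 1)) (by positivity), hℓ.eventually_gt_atTop 0] with i h1 h2 h3 h4 h5
        refine (hjumps (κ i) (t i) (hκ i) (ht i) h3.le).trans ?_
        rw [le_div_iff₀ (by positivity), mul_right_comm]
        refine le_trans ?_ h4
        gcongr
        rw [add_zero, div_right_comm (κ i ^ 2), lt_div_iff₀ h5] at h1
        have h6 := mul_le_mul_of_nonneg_right (mertonF_le δ a hn) h5.le
        rw [← hf] at h6
        change -(n * ℓ i) + D * (κ i + κ i ^ 2 * t i) - κ i ^ 2 / (2 * n * δ ^ 2) ≤ _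
        linarith
    filter_upwards [(Filter.eventually_all_finset _).2 hterms, htail,
      ht0.eventually (gt_mem_nhds one_pos)] with i h1 h2 h3
    refine (hsum N (κ i) (t i) (ht i) h3.le).trans ?_
    have h4 := Finset.sum_le_card_nsmul _ _ _ h1
    rw [Finset.card_range, nsmul_eq_mul] at h4
    have h5 : N * (T i / (N + 1)) + T i / (N + 1) = T i := by field_simp
    change _ ≤ T i
    linarith
  have hg : ∀ i, κ i / √(2 * t i * f * L i) * √(t i) = κ i / √(2 * (f * L i)) := by
    intro i
    have hst : 0 < √(t i) := Real.sqrt_pos.2 (ht i)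
    have : 2 * t i * f * L i = t i * (2 * (f * L i)) := by ring
    rw [this, Real.sqrt_mul (ht i).le, div_mul_eq_mul_div, mul_comm (√(t i)),
      mul_div_mul_right _ _ hst.ne']
  refine hX.tendsto_impliedVol_div (g := fun i => κ i / √(2 * t i * f * L i)) hκ ht ?_
    fun ε hε hε1 => ?_
  · filter_upwards [hκpos, hL.eventually_gt_atTop 0] with i hi hi2
    have := ht i
    positivity
  · have h := eventually_bsCall_bracket hκpos hq hκq hlo hup hε hε1
    filter_upwards [h] with i hi
    simp only [hg]
    exact hi

end Model

/-! ### Strikes requiring an unbounded number of jumps. -/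

section Model

variable {Ω : Type*} [MeasurableSpace Ω] {P : Measure Ω} [IsProbabilityMeasure P]
  {X : ℝ → Ω → ℝ} {μ α σ lam δ : ℝ}

/-- From `n! ≤ n ^ n` and `n ≤ lam * k`, the weight of `n` jumps is at least `exp (-lam t) * (t / k)
^ n`, so each jump costs at most `log (k / t)`. -/
theorem IsMertonModel.le_callPrice_of_many_jumps (hX : IsMertonModel P X μ α σ lam δ)
    {k t : ℝ} (hk : 0 < k) (ht : 0 < t) {n : ℕ} (hn : 1 ≤ n) (hnk : n ≤ lam * k) :
    Real.exp (-(lam * t) - n * Real.log (k / t)) * (1 / 3 *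
      Real.exp (-((k + (1 + |μ| * t + n * (|α| + δ))) ^ 2 / (2 * n * δ ^ 2)))) ≤
      callPrice P X k t := by
  have hn1 : (1:ℝ) ≤ n := by exact_mod_cast hn
  have hn0 : (0:ℝ) < n := by linarith
  have hδ := hX.delta_pos
  have hl := hX.lam_pos
  have hw0 : 0 < √n * δ := by positivity
  refine le_trans ?_ (hX.jumpWeight_mul_le_callPrice ht k n)
  have hp : Real.exp (-(lam * t) - n * Real.log (k / t)) ≤ jumpWeight lam t n := by
    unfold jumpWeight
    rw [sub_eq_add_neg, Real.exp_add, mul_div_assoc]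
    gcongr
    have h1 : Real.exp (-(n * Real.log (k / t))) = (t / k) ^ n := by
      rw [← mul_neg, ← Real.log_inv, inv_div, Real.exp_nat_mul, Real.exp_log (by positivity)]
    rw [h1]
    calc (t / k) ^ n ≤ (lam * t / n) ^ n := by
          gcongr ?_ ^ n
          rw [div_le_div_iff₀ hk hn0]
          nlinarith
      _ = (lam * t) ^ n / n ^ n := by rw [div_pow]
      _ ≤ _ := by
          gcongr
          exact_mod_cast Nat.factorial_le_pow n
  have hw : √n * δ ≤ √(σ ^ 2 * t + n * δ ^ 2) := by
    apply Real.le_sqrt_of_sq_le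
    rw [mul_pow, Real.sq_sqrt hn0.le]
    have : 0 ≤ σ ^ 2 * t := by positivity
    linarith
  have hg := le_gaussCall hk.le (μ * t + n * α) (hw0.trans_le hw)
  have habs : |k + 1 - (μ * t + n * α)| ≤ k + (1 + |μ| * t + n * |α|) := by
    have h3 := abs_le.1 (show |μ * t| ≤ |μ| * t by rw [abs_mul, abs_of_pos ht])
    have h4 := abs_le.1 (show |n * α| ≤ n * |α| by rw [abs_mul, abs_of_pos hn0])
    rw [abs_le]
    constructor <;> linarith
  have hsq : (|k + 1 - (μ * t + n * α)| / √(σ ^ 2 * t + n * δ ^ 2) + 1) ^ 2 / 2 ≤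
      (k + (1 + |μ| * t + n * (|α| + δ))) ^ 2 / (2 * n * δ ^ 2) := by
    have hsn : √(n:ℝ) ≤ n := Real.sqrt_le_iff.2 ⟨hn0.le, by nlinarith⟩
    have h1 : |k + 1 - (μ * t + n * α)| / √(σ ^ 2 * t + n * δ ^ 2) + 1 ≤
        (k + (1 + |μ| * t + n * (|α| + δ))) / (√n * δ) := by
      have h2 : |k + 1 - (μ * t + n * α)| / √(σ ^ 2 * t + n * δ ^ 2) ≤
        (k + (1 + |μ| * t + n * |α|)) / (√n * δ) := by gcongr
      refine (add_le_add_left h2 1).trans ?_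
      rw [div_add_one hw0.ne']
      refine div_le_div_of_nonneg_right ?_ hw0.le
      have := mul_le_mul_of_nonneg_right hsn hδ.le
      linarith
    calc _ ≤ ((k + (1 + |μ| * t + n * (|α| + δ))) / (√n * δ)) ^ 2 / 2 := by gcongr
      _ = _ := by
        rw [div_pow, mul_pow, Real.sq_sqrt hn0.le]; field_simp
  refine mul_le_mul hp (le_trans ?_ hg) (by positivity) (jumpWeight_nonneg hl.le ht.le n)
  gcongr

set_option maxHeartbeats 800000 in
/-- Asymptotics of the implied volatility when the price is governed by an unbounded number of
jumps. -/
theorem IsMertonModel.tendsto_impliedVol_of_many_jumps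
    (hX : IsMertonModel P X μ α σ lam δ) {ι : Type*} {l : Filter ι} {κ t : ι → ℝ}
    (hκ : ∀ i, 0 ≤ κ i) (ht : ∀ i, 0 < t i) {T : ℝ} (htT : ∀ᶠ i in l, t i ≤ T)
    (hκtop : Tendsto κ l atTop)
    (hlog : ∀ M : ℝ, ∀ᶠ i in l, M * Real.log (κ i / t i) ≤ κ i ^ 2) :
    Tendsto (fun i => impliedVol P X (κ i) (t i) /
      √(δ * κ i / (2 * t i * √(2 * Real.log (κ i / t i))))) l (𝓝 1) := by
  have hσ := hX.sigma_pos
  have hδ := hX.delta_pos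
  have hl := hX.lam_pos
  set L : ι → ℝ := fun i => Real.log (κ i / t i) with hLdef
  set S : ι → ℝ := fun i => √(2 * L i) with hSdef
  set q : ι → ℝ := fun i => κ i * S i / δ with hqdef
  have hκpos := hκtop.eventually_gt_atTop 0
  have hL : Tendsto L l atTop := by
    refine Real.tendsto_log_atTop.comp (tendsto_atTop_mono' l ?_
      (hκtop.atTop_div_const (show 0 < |T| + 1 by positivity)))
    filter_upwards [htT] with i hi
    have := hκ i
    have := ht i
    gcongr
    linarith [le_abs_self T]
  have hS : Tendsto S l atTop :=
    Real.tendsto_sqrt_atTop.comp (hL.const_mul_atTop two_pos)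
  have hSsq : ∀ᶠ i in l, S i ^ 2 = 2 * L i := by
    filter_upwards [hL.eventually_ge_atTop 0] with i hi
    exact Real.sq_sqrt (by linarith)
  have hq : Tendsto q l atTop := (hκtop.atTop_mul_atTop₀ hS).atTop_div_const hδ
  have hκq : Tendsto (fun i => κ i / q i) l (𝓝 0) := by
    have h1 := hS.inv_tendsto_atTop.const_mul δ
    rw [mul_zero] at h1
    refine h1.congr' ?_
    filter_upwards [hκpos, hS.eventually_gt_atTop 0] with i hi hi2
    simp only [hqdef, Pi.inv_apply]
    field_simp
  have hκsmall : ∀ D η : ℝ, 0 < η → ∀ᶠ i in l, D * κ i ≤ η * q i := by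
    intro D η hη
    filter_upwards [(hκq.const_mul D).eventually (gt_mem_nhds (by simpa using hη)),
      hq.eventually_gt_atTop 0] with i hi hi0
    rw [← mul_div_assoc, div_lt_iff₀ hi0] at hi
    exact hi.le
  have hlo : ∀ ε : ℝ, 0 < ε →
      ∀ᶠ i in l, κ i * Real.exp (-((1 + ε) * q i)) ≤ callPrice P X (κ i) (t i) := by
    intro ε hε
    set η := min ε 1 / 8 with hη
    have hη0 : 0 < η := by positivity
    have hηε : 8 * η ≤ ε := by rw [hη]; linarith [min_le_left ε 1]
    have hη1 : 8 * η ≤ 1 := by rw [hη]; linarith [min_le_right ε 1]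
    -- The minimizer of `x L + κ² / (2 x δ²)`; both summands then equal `q / 2`. It tends to
    -- infinity, so rounding up is harmless, and it is `o(κ)`, so the drift of the jumps is
    -- negligible.
    set x : ι → ℝ := fun i => κ i / (δ * S i) with hxdef
    have hx : Tendsto x l atTop := by
      rw [tendsto_atTop]
      intro b
      filter_upwards [hlog (2 * δ ^ 2 * b ^ 2), hSsq, hS.eventually_gt_atTop 0] with i h1 h2 h3
      rw [hxdef, le_div_iff₀ (by positivity)]
      refine abs_le_of_sq_le_sq' ?_ (hκ i) |>.2
      rw [mul_pow, mul_pow, h2]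
      linarith
    have hxsmall : ∀ c : ℝ, 0 < c → ∀ᶠ i in l, x i ≤ c * κ i := by
      intro c hc
      filter_upwards [hS.eventually_ge_atTop (1 / (δ * c)), hκpos] with i h1 h2
      have hS0 : 0 < S i := lt_of_lt_of_le (by positivity) h1
      rw [hxdef, div_le_iff₀ (by positivity)]
      rw [div_le_iff₀ (by positivity)] at h1
      nlinarith
    filter_upwards [hx.eventually_ge_atTop 1, hx.eventually_ge_atTop (1 / η),
      hxsmall (lam / 2) (by positivity), hxsmall (η / (4 * (|α| + δ))) (by positivity),
      hκtop.eventually_ge_atTop ((1 + |μ| * T) * (2 / η)), htT, hκpos, hSsq,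
      hS.eventually_gt_atTop 0, hκsmall 1 η hη0,
      (hq.const_mul_atTop hη0).eventually_ge_atTop (lam * T + 2)]
      with i hx1 hxη hxl hxα hκT hT hκ0 hS2 hS0 hκη hqη
    set n := ⌈x i⌉₊ with hn
    have hxn : x i ≤ n := Nat.le_ceil _
    have hn1 : 1 ≤ n := Nat.one_le_iff_ne_zero.2 (by
      rintro h0; rw [h0] at hxn; push_cast at hxn; linarith)
    have hnx : (n:ℝ) ≤ (1 + η) * x i := by
      have h1 := (Nat.ceil_lt_add_one (show 0 ≤ x i by linarith)).le
      have h2 : 1 ≤ x i * η := (div_le_iff₀ hη0).1 hxη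
      linarith
    have hn0 : (0:ℝ) < n := by linarith
    have hn2x : (n:ℝ) ≤ 2 * x i := by nlinarith
    have hti := ht i
    refine le_trans ?_ (hX.le_callPrice_of_many_jumps hκ0 hti hn1 (by linarith))
    have hsum : κ i + (1 + |μ| * t i + n * (|α| + δ)) ≤ (1 + η) * κ i := by
      have h1 : n * (|α| + δ) ≤ η / 2 * κ i := by
        calc n * (|α| + δ) ≤ (2 * (η / (4 * (|α| + δ)) * κ i)) * (|α| + δ) := by
              gcongr; linarith
          _ = _ := by field_simp; ring
      have h2 : 1 + |μ| * t i ≤ η / 2 * κ i := by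
        have h3 : (1 + |μ| * T) ≤ η / 2 * κ i := by
          calc (1 + |μ| * T) = η / 2 * ((1 + |μ| * T) * (2 / η)) := by field_simp
            _ ≤ _ := by gcongr
        have h4 : |μ| * t i ≤ |μ| * T := by gcongr
        linarith
      linarith
    have hxq : κ i ^ 2 / (2 * x i * δ ^ 2) = q i / 2 := by
      simp only [hxdef, hqdef]
      field_simp
    have hxL : x i * L i = q i / 2 := by
      have h1 : L i = S i ^ 2 / 2 := by linarith
      rw [h1]
      simp only [hxdef, hqdef]
      field_simp
    have hq0 : 0 ≤ q i := by simp only [hqdef]; positivity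
    have hL0 : 0 ≤ L i := by linarith [sq_nonneg (S i)]
    have hE1 : n * L i ≤ (1 + η) * (q i / 2) := by
      calc n * L i ≤ (1 + η) * x i * L i := by gcongr
        _ = _ := by rw [mul_assoc, hxL]
    have hE2 : (κ i + (1 + |μ| * t i + n * (|α| + δ))) ^ 2 / (2 * n * δ ^ 2) ≤
        (1 + 3 * η) * (q i / 2) := by
      calc _ ≤ ((1 + η) * κ i) ^ 2 / (2 * x i * δ ^ 2) := by gcongr
        _ = (1 + η) ^ 2 * (q i / 2) := by rw [mul_pow, mul_div_assoc, hxq]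
        _ ≤ _ := by
          have h5 : η * η ≤ η * 1 := by gcongr; linarith
          gcongr; linarith
    have hlT : lam * t i ≤ lam * T := by gcongr
    have h3 : Real.exp (-2) ≤ 1 / 3 := by
      rw [Real.exp_neg, one_div]
      exact inv_anti₀ (by norm_num) (by linarith [Real.add_one_le_exp (2:ℝ)])
    calc κ i * Real.exp (-((1 + ε) * q i))
        ≤ Real.exp (η * q i) * Real.exp (-((1 + ε) * q i)) := by
          gcongr
          have := Real.add_one_le_exp (κ i)
          have := Real.exp_le_exp.2 (show κ i ≤ η * q i by linarith)
          linarith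
      _ = Real.exp (η * q i + -((1 + ε) * q i)) := by rw [Real.exp_add]
      _ ≤ Real.exp ((-(lam * t i) - n * L i) + (-2 +
          -((κ i + (1 + |μ| * t i + n * (|α| + δ))) ^ 2 / (2 * n * δ ^ 2)))) := by
          apply Real.exp_le_exp.2
          have := mul_le_mul_of_nonneg_right hηε hq0
          linarith
      _ = Real.exp (-(lam * t i) - n * L i) * (Real.exp (-2) *
          Real.exp (-((κ i + (1 + |μ| * t i + n * (|α| + δ))) ^ 2 / (2 * n * δ ^ 2)))) := by
          rw [Real.exp_add, Real.exp_add]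
      _ ≤ _ := by gcongr
  have hup : ∀ ε : ℝ, 0 < ε →
      ∀ᶠ i in l, callPrice P X (κ i) (t i) ≤ κ i * Real.exp (-((1 - ε) * q i)) := by
    intro ε hε
    -- For `ε ≥ 1` the right side is at least `1`, while the price is below `1`.
    rcases le_or_gt 1 ε with h1ε | hε1
    · filter_upwards [hκtop.eventually_ge_atTop 1, hq.eventually_ge_atTop 0] with i h1 h2
      refine (hX.callPrice_lt_one (ht i)).le.trans ?_
      have : 1 ≤ Real.exp (-((1 - ε) * q i)) := Real.one_le_exp (by nlinarith)
      nlinarith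
    -- The Chernoff parameter will be `ρ S / δ`, just below the critical `S / δ`: the exponential
    -- moment of a jump is then at most `exp L = κ / t`. The jump part of the log-moment is thus
    -- `O(κ) = o(q)`, and the leading exponent is `-ρ q`.
    set ρ := 1 - ε / 2 with hρ
    have hρ0 : 0 < ρ := by rw [hρ]; linarith
    have hρ1 : ρ < 1 := by rw [hρ]; linarith
    set m := |μ| + σ ^ 2 / 2 with hm
    have hm0 : 0 < m := by positivity
    set β := |α| + δ ^ 2 with hβ
    have hβ0 : 0 < β := by positivity
    have hE : ∀ᶠ i in l, β + ρ * S i / δ * β ≤ (1 - ρ) * L i := by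
      filter_upwards [hSsq, hS.eventually_ge_atTop 1,
        hS.eventually_ge_atTop ((β + ρ / δ * β) * 2 / (1 - ρ))] with i h1 h2 h3
      have h4 : L i = S i * S i / 2 := by rw [← sq]; linarith
      rw [div_le_iff₀ (by linarith)] at h3
      rw [h4]
      have h5 : β ≤ β * S i := le_mul_of_one_le_right hβ0.le h2
      have h6 : β + ρ * S i / δ * β ≤ (β + ρ / δ * β) * S i := by
        have : ρ * S i / δ * β = ρ / δ * β * S i := by ring
        rw [this, add_mul]; linarith
      nlinarith
    filter_upwards [hκtop.eventually_ge_atTop 1, hE, hSsq, hS.eventually_ge_atTop 1, htT, hκpos,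
      hκsmall (m * (2 * T + 4 / δ ^ 2) + lam) (ε / 2) (half_pos hε)]
      with i hκ1 hEi hS2 hS1 hT hκ0 hκε
    have hti := ht i
    set s := ρ * S i / δ with hs
    have hs0 : 0 ≤ s := by positivity
    refine le_trans (hX.callPrice_le_exp hs0 hti (κ i)) ?_
    refine le_trans ?_ (le_mul_of_one_le_left (Real.exp_nonneg _) hκ1)
    apply Real.exp_le_exp.2
    have hL0 : 0 ≤ L i := by linarith [sq_nonneg (S i)]
    have hexpL : t i * Real.exp (L i) = κ i := by
      simp only [hLdef]
      rw [Real.exp_log (by positivity)]; field_simp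
    have htL : t i * L i ≤ κ i := by
      rw [← hexpL]
      gcongr
      linarith [Real.add_one_le_exp (L i)]
    have hsκ : s * κ i = ρ * q i := by
      simp only [hs, hqdef]; ring
    have hs2 : s ^ 2 * δ ^ 2 = 2 * ρ ^ 2 * L i := by
      rw [hs, div_pow, mul_pow, hS2]; field_simp
    have hs2' : s ^ 2 ≤ 2 * L i / δ ^ 2 := by
      rw [le_div_iff₀ (by positivity), hs2]
      have := mul_le_mul_of_nonneg_right (pow_le_one₀ (n := 2) hρ0.le hρ1.le) hL0
      linarith
    have hJ : Real.exp ((1 + s) * α + (1 + s) ^ 2 * (δ ^ 2 / 2)) ≤ Real.exp (L i) := by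
      apply Real.exp_le_exp.2
      have h1 : (1 + s) * α ≤ (1 + s) * |α| := by gcongr; exact le_abs_self α
      have h2 : ρ ^ 2 * L i ≤ ρ * L i := by
        gcongr
        rw [sq]
        exact mul_le_of_le_one_left hρ0.le hρ1.le
      have h3 : 0 < δ ^ 2 := by positivity
      have h4 : (1 + s) ^ 2 * (δ ^ 2 / 2) = δ ^ 2 / 2 + s * δ ^ 2 + ρ ^ 2 * L i := by
        linear_combination hs2 / 2
      rw [h4]
      rw [hβ] at hEi
      linarith
    have hD : (1 + s) * μ + 1 / 2 * (1 + s) ^ 2 * σ ^ 2 ≤ m * (2 + 4 * L i / δ ^ 2) := by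
      have h1 : (1 + s) * μ ≤ (1 + s) ^ 2 * |μ| := by
        have := le_abs_self μ
        have := abs_nonneg μ
        nlinarith
      have h2 : (1 + s) ^ 2 ≤ 2 + 4 * L i / δ ^ 2 := by
        have h3 : (1 + s) ^ 2 ≤ 2 + 2 * s ^ 2 := by nlinarith [sq_nonneg (1 - s)]
        have h4 : 4 * L i / δ ^ 2 = 2 * (2 * L i / δ ^ 2) := by ring
        linarith
      calc _ ≤ m * (1 + s) ^ 2 := by rw [hm]; linarith
        _ ≤ _ := by gcongr
    have hψ : t i * ((1 + s) * μ + 1 / 2 * (1 + s) ^ 2 * σ ^ 2 +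
        lam * (Real.exp ((1 + s) * α + (1 + s) ^ 2 * (δ ^ 2 / 2)) - 1)) ≤
        (m * (2 * T + 4 / δ ^ 2) + lam) * κ i := by
      calc _ ≤ t i * (m * (2 + 4 * L i / δ ^ 2) + lam * Real.exp (L i)) := by
            gcongr
            linarith
        _ = m * (2 * t i + 4 / δ ^ 2 * (t i * L i)) + lam * (t i * Real.exp (L i)) := by ring
        _ ≤ m * (2 * (T * κ i) + 4 / δ ^ 2 * κ i) + lam * κ i := by
            rw [hexpL]
            gcongr
            exact hT.trans (le_mul_of_one_le_right (hti.le.trans hT) hκ1)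
        _ = _ := by ring
    have hρq : (1 - ε) * q i = ρ * q i - ε / 2 * q i := by rw [hρ]; ring
    linarith
  have hg : ∀ᶠ i in l, √(δ * κ i / (2 * t i * S i)) * √(t i) = κ i / √(2 * q i) := by
    filter_upwards [hκpos, hS.eventually_gt_atTop 0] with i hi hi2
    have hti := ht i
    have hst : 0 < √(t i) := Real.sqrt_pos.2 hti
    rw [← Real.sqrt_mul (by positivity)]
    conv_rhs => rw [← Real.sqrt_sq hi.le]
    rw [← Real.sqrt_div (by positivity)]
    congr 1
    simp only [hqdef]
    field_simp
  refine hX.tendsto_impliedVol_div (g := fun i => √(δ * κ i / (2 * t i * S i))) hκ ht ?_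
    fun ε hε hε1 => ?_
  · filter_upwards [hκpos, hS.eventually_gt_atTop 0] with i hi hi2
    have := ht i
    positivity
  · filter_upwards [eventually_bsCall_bracket hκpos hq hκq hlo hup hε hε1, hg] with i hi hgi
    simp only [hgi]
    exact hi

end Model

/-! ### The uniform formula and the final assembly. -/

theorem Ultrafilter.exists_tendsto_of_bounded {ι : Type*} (u : Ultrafilter ι) {f : ι → ℝ} {M : ℝ}
    (h0 : ∀ᶠ i in (u : Filter ι), 0 ≤ f i) (hM : ∀ᶠ i in (u : Filter ι), f i ≤ M) :
    ∃ a, 0 ≤ a ∧ Tendsto f u (𝓝 a) := by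
  obtain ⟨a, ha, hle⟩ := isCompact_iff_ultrafilter_le_nhds.1
    (isCompact_Icc (a := (0:ℝ)) (b := M)) (u.map f)
    (le_principal_iff.2 (h0.and hM))
  exact ⟨a, ha.1, hle⟩

theorem kbar1_eq {t : ℝ} (ht : 0 ≤ t) : kbar1 t = √t * kbar2 t := Real.sqrt_mul ht _

theorem tendsto_kbar2 {ι : Type*} {l : Filter ι} {t : ι → ℝ} (ht : ∀ i, 0 < t i)
    (ht0 : Tendsto t l (𝓝 0)) : Tendsto (fun i => kbar2 (t i)) l atTop :=
  Real.tendsto_sqrt_atTop.comp (tendsto_log_one_div_atTop ht ht0)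

theorem eventually_kbar1_le {σ : ℝ} {ι : Type*} {l : Filter ι} {κ t : ι → ℝ}
    (ht : ∀ i, 0 < t i) (ht0 : Tendsto t l (𝓝 0)) {a : ℝ} (ha : 0 < a)
    (hlim : Tendsto (fun i => κ i / kbar2 (t i)) l (𝓝 a)) :
    ∀ᶠ i in l, σ * kbar1 (t i) ≤ κ i := by
  have h1 : Tendsto (fun i => σ * √(t i)) l (𝓝 0) := by
    simpa using ((Real.continuous_sqrt.tendsto 0).comp ht0).const_mul σ
  filter_upwards [hlim.eventually (lt_mem_nhds (half_lt_self ha)),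
    h1.eventually (gt_mem_nhds (half_pos ha)), (tendsto_kbar2 ht ht0).eventually_gt_atTop 0]
    with i h2 h3 h4
  rw [lt_div_iff₀ h4] at h2
  rw [kbar1_eq (ht i).le, ← mul_assoc]
  exact (mul_le_mul_of_nonneg_right h3.le h4.le).trans h2.le

/-- `log (κ / t)` in terms of `R = κ² / (2 σ² t)`. -/
theorem log_div_eq_half_log {σ k t : ℝ} (hσ : 0 < σ) (hk : 0 < k) (ht : 0 < t) :
    Real.log (k / t) =
      Real.log (2 * σ ^ 2 * (k ^ 2 / (2 * σ ^ 2 * t))) / 2 + Real.log (1 / t) / 2 := by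
  have h1 : 2 * σ ^ 2 * (k ^ 2 / (2 * σ ^ 2 * t)) = k ^ 2 / t := by field_simp
  rw [h1, Real.log_div hk.ne' ht.ne', Real.log_div (by positivity) ht.ne', Real.log_pow,
    one_div, Real.log_inv]
  push_cast; ring

/-- Below the scale `kbar1`, the jump part of the limiting smile is dominated by `σ`. -/
theorem tendsto_max_div_of_le_kbar1 {σ δ θ : ℝ} (hσ : 0 < σ) (hθ : 1 < θ) {ι : Type*}
    {l : Filter ι} {κ t : ι → ℝ} (ht : ∀ i, 0 < t i)
    (ht0 : Tendsto t l (𝓝 0)) (hle : ∀ᶠ i in l, κ i ≤ σ * kbar1 (t i)) :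
    Tendsto (fun i => max σ (if θ * t i ≤ κ i then
      κ i / √(2 * t i * mertonF δ (κ i / kbar2 (t i)) * Real.log (κ i / t i)) else 0) / σ)
      l (𝓝 1) := by
  have hℓ := tendsto_log_one_div_atTop ht ht0
  have hθ0 : 0 < Real.log θ := Real.log_pos hθ
  rw [Metric.tendsto_nhds]
  intro ε hε
  -- With `R = κ² / (2 σ² t)`, the squared ratio of the jump term to `σ` is `R / (f L)`, so `R ≤ (1
  -- + ε) L` suffices. If `R ≤ log θ` this is clear, as `θ` keeps `L ≥ log θ`. Otherwise `L ≥ ℓ / 2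
  -- - C ≥ R - C`, and `C ≤ ε L` for large `ℓ`.
  set C := -(Real.log (2 * σ ^ 2 * Real.log θ) / 2) with hC
  filter_upwards [hle, hℓ.eventually_ge_atTop (2 * (C + |C| / ε)), hℓ.eventually_ge_atTop 0]
    with i hlei hℓi hℓ0
  have hti := ht i
  set ℓ := Real.log (1 / t i)
  have hmax : max σ (if θ * t i ≤ κ i then
      κ i / √(2 * t i * mertonF δ (κ i / kbar2 (t i)) * Real.log (κ i / t i)) else 0) ≤
      (1 + ε / 2) * σ := by
    refine max_le (le_mul_of_one_le_left hσ.le (by linarith)) ?_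
    split_ifs with hθt
    swap
    · positivity
    have hk0 : 0 < κ i := lt_of_lt_of_le (by positivity) hθt
    set L := Real.log (κ i / t i) with hL
    have hLθ : Real.log θ ≤ L := by
      apply Real.log_le_log (by linarith)
      rwa [le_div_iff₀ hti]
    have hL0 : 0 < L := hθ0.trans_le hLθ
    set f := mertonF δ (κ i / kbar2 (t i))
    have hf1 : 1 ≤ f := one_le_mertonF _ _
    set R := κ i ^ 2 / (2 * σ ^ 2 * t i) with hR
    have hRL : R ≤ (1 + ε) * L := by
      rcases le_total R (Real.log θ) with h | h
      · nlinarith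
      · have h1 := log_div_eq_half_log hσ hk0 hti
        have h2 : Real.log (2 * σ ^ 2 * Real.log θ) ≤ Real.log (2 * σ ^ 2 * R) := by
          apply Real.log_le_log (by positivity)
          gcongr
        have h3 : R ≤ ℓ / 2 := by
          rw [hR, div_le_iff₀ (by positivity)]
          have h4 : κ i ^ 2 ≤ (σ * kbar1 (t i)) ^ 2 := by gcongr
          rw [mul_pow, kbar1, Real.sq_sqrt (mul_nonneg hti.le hℓ0)] at h4
          change κ i ^ 2 ≤ σ ^ 2 * (t i * ℓ) at h4
          linarith
        have h5 : ℓ / 2 - C ≤ L := by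
          rw [hC, hL, h1]; linarith
        have h6 : |C| / ε ≤ L := by linarith
        rw [div_le_iff₀ hε] at h6
        linarith [le_abs_self C]
    have hs : 0 < √(2 * t i * f * L) := Real.sqrt_pos.2 (by positivity)
    rw [div_le_iff₀ hs]
    refine abs_le_of_sq_le_sq' ?_ (by positivity) |>.2
    rw [mul_pow, Real.sq_sqrt (by positivity)]
    have h1 : κ i ^ 2 = R * (2 * σ ^ 2 * t i) := by rw [hR]; field_simp
    have h2 : 1 + ε ≤ (1 + ε / 2) ^ 2 := by nlinarith
    calc κ i ^ 2 = R * (2 * σ ^ 2 * t i) := h1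
      _ ≤ ((1 + ε / 2) ^ 2 * (f * L)) * (2 * σ ^ 2 * t i) := by
        gcongr
        refine hRL.trans ?_
        gcongr
        exact le_mul_of_one_le_left hL0.le hf1
      _ = _ := by ring
  have h1 : 1 ≤ max σ (if θ * t i ≤ κ i then
      κ i / √(2 * t i * mertonF δ (κ i / kbar2 (t i)) * Real.log (κ i / t i)) else 0) / σ := by
    rw [le_div_iff₀ hσ, one_mul]; exact le_max_left _ _
  have h2 := (div_le_iff₀ hσ).2 hmax
  rw [Real.dist_eq, abs_lt]
  constructor <;> linarith

/-- Above the scale `kbar1`, the jump part of the limiting smile dominates `σ`. -/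
theorem tendsto_max_div_of_kbar1_le {σ δ θ : ℝ} (hσ : 0 < σ) (hδ : 0 < δ) {ι : Type*}
    {l : Filter ι} {κ t : ι → ℝ} (hκ : ∀ i, 0 ≤ κ i) (ht : ∀ i, 0 < t i)
    (ht0 : Tendsto t l (𝓝 0)) (hge : ∀ᶠ i in l, σ * kbar1 (t i) ≤ κ i) {a : ℝ} (ha : 0 ≤ a)
    (hlim : Tendsto (fun i => κ i / kbar2 (t i)) l (𝓝 a)) :
    Tendsto (fun i => max σ (if θ * t i ≤ κ i then
      κ i / √(2 * t i * mertonF δ (κ i / kbar2 (t i)) * Real.log (κ i / t i)) else 0) /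
      (κ i / √(2 * t i * mertonF δ a * Real.log (κ i / t i)))) l (𝓝 1) := by
  obtain ⟨-, -, hR, hκpos, -, hLℓ, -, hcases⟩ :=
    scale_bounds hσ δ hκ ht ht0 hge ha hlim rfl rfl
  have hℓ := tendsto_log_one_div_atTop ht ht0
  set f := mertonF δ a with hf
  have hf1 : 1 ≤ f := one_le_mertonF δ a
  set R : ι → ℝ := fun i => κ i ^ 2 / (2 * σ ^ 2 * t i) with hRdef
  have hRtop : Tendsto R l atTop := tendsto_atTop_mono' l hR (hℓ.atTop_div_const two_pos)
  have hratio : Tendsto (fun i => √(f / mertonF δ (κ i / kbar2 (t i)))) l (𝓝 1) := by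
    have h1 := ((continuous_mertonF hδ).tendsto a).comp hlim
    have h2 := ((tendsto_const_nhds (x := f)).div h1 (by rw [← hf]; linarith)).sqrt
    rw [← hf, div_self (by linarith), Real.sqrt_one] at h2
    exact h2
  -- This dominates the ratio of `σ` to the jump term, whose square is `f L / R`: combine `ℓ / 2 +
  -- (f - 1) L ≤ R` with `L = log (2 σ² R) / 2 + ℓ / 2`.
  have hlogR : Tendsto (fun i => √(1 + Real.log (2 * σ ^ 2 * R i) / 2 / R i)) l (𝓝 1) := by
    have h1 : Tendsto (fun i => 2 * σ ^ 2 * R i) l atTop :=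
      hRtop.const_mul_atTop (by positivity)
    have h2 := (Real.isLittleO_log_id_atTop.tendsto_div_nhds_zero.comp h1).const_mul (σ ^ 2)
    have h3 := ((h2.const_add 1).sqrt)
    rw [mul_zero, add_zero, Real.sqrt_one] at h3
    refine h3.congr' ?_
    filter_upwards [hRtop.eventually_gt_atTop 0] with i hi
    simp only [Function.comp_apply, id]
    congr 2
    field_simp
  have hup : Tendsto (fun i => max (√(f / mertonF δ (κ i / kbar2 (t i))))
      (√(1 + Real.log (2 * σ ^ 2 * R i) / 2 / R i))) l (𝓝 1) := by
    simpa using hratio.max hlogR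
  refine tendsto_of_tendsto_of_tendsto_of_le_of_le' hratio hup ?_ ?_
  all_goals
    filter_upwards [hκpos, hLℓ, hcases, hℓ.eventually_gt_atTop 0,
      hℓ.eventually_ge_atTop (2 * Real.log (max θ 1)), hRtop.eventually_gt_atTop 0]
      with i hk hL hc hℓ0 hθ hR0
    have hti := ht i
    have hL0 : 0 < Real.log (κ i / t i) := by linarith
    have hθt : θ * t i ≤ κ i := by
      have h1 : Real.log (max θ 1) ≤ Real.log (κ i / t i) := by linarith
      have h2 := (Real.log_le_log_iff (lt_max_of_lt_right one_pos) (by positivity)).1 h1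
      have h3 := (le_max_left θ 1).trans h2
      rwa [le_div_iff₀ hti] at h3
    have hf' : 1 ≤ mertonF δ (κ i / kbar2 (t i)) := one_le_mertonF _ _
    set f' := mertonF δ (κ i / kbar2 (t i))
    rw [if_pos hθt, ← max_div_div_right (by positivity)]
    have hG : κ i / √(2 * t i * f' * Real.log (κ i / t i)) /
        (κ i / √(2 * t i * f * Real.log (κ i / t i))) = √(f / f') := by
      rw [div_div_div_cancel_left' _ _ hk.ne', ← Real.sqrt_div (by positivity)]
      congr 1
      field_simp
    rw [hG]
  · exact le_max_right _ _
  · rw [max_comm]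
    refine max_le_max le_rfl ?_
    have h1 := log_div_eq_half_log hσ hk hti
    have h2 : σ ^ 2 / (κ i ^ 2 / (2 * t i * f * Real.log (κ i / t i))) =
        f * Real.log (κ i / t i) / R i := by
      simp only [hRdef]; field_simp
    apply Real.le_sqrt_of_sq_le
    rw [div_pow, div_pow, Real.sq_sqrt (by positivity), h2, div_le_iff₀ hR0, add_mul, one_mul,
      div_mul_cancel₀ _ hR0.ne']
    change Real.log (κ i / t i) = Real.log (2 * σ ^ 2 * R i) / 2 + _ at h1
    linarith [hc.2]

theorem theorem3p4 {Ω : Type*} [MeasurableSpace Ω] (P : Measure Ω) [IsProbabilityMeasure P]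
    (X : ℝ → Ω → ℝ) (μ α σ lam δ : ℝ) (hX : IsMertonModel P X μ α σ lam δ) :
    -- the implied volatility is well defined
    (∀ k t : ℝ, 0 ≤ k → 0 < t → ∃! s : ℝ, IsImpliedVol P X k t s) ∧
    -- asymptotics along an arbitrary family of values of `(κ, t)`
    ∀ {ι : Type*} (l : Filter ι) (κ t : ι → ℝ), (∀ i, 0 ≤ κ i) → (∀ i, 0 < t i) →
      -- `t → 0` and `κ = O(kbar2 t)`
      ((Tendsto t l (𝓝 0) → κ =O[l] (fun i => kbar2 (t i)) →
          ∀ θ : ℝ, 1 < θ →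
            Tendsto (fun i => impliedVol P X (κ i) (t i) /
              max σ (if θ * t i ≤ κ i then
                κ i / √(2 * t i * mertonF δ (κ i / kbar2 (t i)) * Real.log (κ i / t i))
                else 0)) l (𝓝 1)) ∧
        -- `t → 0` and `κ ≤ σ kbar1 t`
        (Tendsto t l (𝓝 0) → (∀ᶠ i in l, κ i ≤ σ * kbar1 (t i)) →
          Tendsto (fun i => impliedVol P X (κ i) (t i) / σ) l (𝓝 1)) ∧
        -- `t → 0` and `σ kbar1 t ≤ κ ≪ kbar2 t`
        (Tendsto t l (𝓝 0) → (∀ᶠ i in l, σ * kbar1 (t i) ≤ κ i) →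
          κ =o[l] (fun i => kbar2 (t i)) →
          Tendsto (fun i => impliedVol P X (κ i) (t i) /
            (κ i / √(2 * t i * Real.log (κ i / t i)))) l (𝓝 1)) ∧
        -- `t → 0` and `κ ∼ a kbar2 t` with `a ∈ (0, ∞)`
        (∀ a : ℝ, 0 < a → Tendsto t l (𝓝 0) →
          Tendsto (fun i => κ i / kbar2 (t i)) l (𝓝 a) →
          Tendsto (fun i => impliedVol P X (κ i) (t i) /
            (κ i / √(2 * t i * mertonF δ a * Real.log (κ i / t i)))) l (𝓝 1)) ∧
        -- `t → 0` and `κ ≫ kbar2 t`, or `t → T ∈ (0, ∞)` and `κ → ∞`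
        ((Tendsto t l (𝓝 0) ∧ (fun i => kbar2 (t i)) =o[l] κ) ∨
            (∃ T : ℝ, 0 < T ∧ Tendsto t l (𝓝 T) ∧ Tendsto κ l atTop) →
          Tendsto (fun i => impliedVol P X (κ i) (t i) /
            √(δ * κ i / (2 * t i * √(2 * Real.log (κ i / t i))))) l (𝓝 1))) := by
  have hσ := hX.sigma_pos
  have hδ := hX.delta_pos
  refine ⟨fun k t hk ht => hX.existsUnique_isImpliedVol hk ht, ?_⟩
  intro ι l κ t hκ ht
  refine ⟨?_, ?_, ?_, ?_, ?_⟩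
  · intro ht0 hO θ hθ
    obtain ⟨M, hM⟩ := hO.bound
    -- Along an ultrafilter the bounded ratio `κ / kbar2 t` converges and one of the two regimes
    -- holds eventually, so no subsequences are needed for a general filter.
    rw [tendsto_iff_ultrafilter]
    intro u hu
    have ht0u := ht0.mono_left hu
    have hk2 := (tendsto_kbar2 ht ht0u).eventually_gt_atTop 0
    obtain ⟨a, ha, hlim⟩ := u.exists_tendsto_of_bounded (f := fun i => κ i / kbar2 (t i)) (M := M)
      (Eventually.of_forall fun i => div_nonneg (hκ i) (Real.sqrt_nonneg _)) (by
        filter_upwards [hu hM, hk2] with i hi hi2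
        rw [Real.norm_of_nonneg (hκ i), Real.norm_of_nonneg hi2.le] at hi
        exact (div_le_iff₀ hi2).2 hi)
    rcases u.em (fun i => σ * kbar1 (t i) ≤ κ i) with hge | hlt
    · have h1 := hX.tendsto_impliedVol_of_tendsto_div_kbar2 hκ ht ht0u hge ha hlim
      have h2 := tendsto_max_div_of_kbar1_le (θ := θ) hσ hδ hκ ht ht0u hge ha hlim
      obtain ⟨-, -, -, hκpos, -, hLℓ, -, -⟩ := scale_bounds hσ δ hκ ht ht0u hge ha hlim rfl rfl
      have h3 := h1.div h2 one_ne_zero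
      rw [div_one] at h3
      refine h3.congr' ?_
      filter_upwards [hκpos, hLℓ, (tendsto_log_one_div_atTop ht ht0u).eventually_gt_atTop 0]
        with i hk hL hℓ
      have hti := ht i
      have hL0 : 0 < Real.log (κ i / t i) := by linarith
      have hf := one_le_mertonF δ a
      refine div_div_div_cancel_right₀ (ne_of_gt ?_) _ _
      positivity
    · have hle : ∀ᶠ i in (u : Filter ι), κ i ≤ σ * kbar1 (t i) :=
        hlt.mono fun i hi => (not_le.1 hi).le
      have h3 := (hX.tendsto_impliedVol_of_le_kbar1 hκ ht ht0u hle).div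
        (tendsto_max_div_of_le_kbar1 (δ := δ) hσ hθ ht ht0u hle) one_ne_zero
      rw [div_one] at h3
      exact h3.congr fun i => div_div_div_cancel_right₀ hσ.ne' _ _
  · exact fun ht0 hle => hX.tendsto_impliedVol_of_le_kbar1 hκ ht ht0 hle
  · intro ht0 hge ho
    -- This is the case `a = 0`, where one jump is optimal.
    have h := hX.tendsto_impliedVol_of_tendsto_div_kbar2 hκ ht ht0 hge le_rfl
      ho.tendsto_div_nhds_zero
    simpa only [mertonF_zero, mul_one] using h
  · intro a ha ht0 hlim
    exact hX.tendsto_impliedVol_of_tendsto_div_kbar2 hκ ht ht0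
      (eventually_kbar1_le ht ht0 ha hlim) ha.le hlim
  · rintro (⟨ht0, ho⟩ | ⟨T, hT, htT, hκtop⟩)
    · have hk2 := tendsto_kbar2 ht ht0
      have hbound : ∀ M : ℝ, 0 < M → ∀ᶠ i in l, M * kbar2 (t i) ≤ κ i := by
        intro M hM
        filter_upwards [ho.bound (inv_pos.2 hM), hk2.eventually_ge_atTop 0] with i hi hi2
        rw [Real.norm_of_nonneg hi2, Real.norm_of_nonneg (hκ i)] at hi
        rwa [← div_eq_inv_mul, le_div_iff₀' hM] at hi
      have hκtop : Tendsto κ l atTop :=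
        tendsto_atTop_mono' l ((hbound 1 one_pos).mono fun i hi => by rwa [one_mul] at hi) hk2
      -- It remains to see `κ² ≫ L`: here `L ≤ κ + ℓ`, and `κ²` dominates `κ` because `κ → ∞` and
      -- `ℓ` because `κ ≫ √ℓ`.
      refine hX.tendsto_impliedVol_of_many_jumps hκ ht (ht0.eventually (ge_mem_nhds one_pos))
        hκtop fun M => ?_
      filter_upwards [hbound (|M| + 1) (by positivity), hκtop.eventually_ge_atTop (2 * |M| + 1),
        (tendsto_log_one_div_atTop ht ht0).eventually_ge_atTop 0] with i h1 h2 h3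
      have hk1 : 1 ≤ κ i := by linarith [abs_nonneg M]
      have hL : Real.log (κ i / t i) = Real.log (κ i) + Real.log (1 / t i) := by
        rw [Real.log_div (by positivity) (ht i).ne', one_div, Real.log_inv]; ring
      have hlogκ := Real.log_nonneg hk1
      have hlogκ' := Real.log_le_sub_one_of_pos (show 0 < κ i by linarith)
      set ℓ := Real.log (1 / t i)
      have h4 : (|M| + 1) ^ 2 * ℓ ≤ κ i ^ 2 := by
        have h5 : ((|M| + 1) * kbar2 (t i)) ^ 2 ≤ κ i ^ 2 := by
          have : 0 ≤ kbar2 (t i) := Real.sqrt_nonneg _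
          gcongr
        rwa [mul_pow, kbar2, Real.sq_sqrt h3] at h5
      calc M * Real.log (κ i / t i) ≤ |M| * (κ i + ℓ) := by
            rw [hL]
            exact mul_le_mul (le_abs_self M) (by linarith) (by linarith) (abs_nonneg M)
        _ ≤ κ i ^ 2 := by
            have h6 : 2 * |M| * ℓ ≤ (|M| + 1) ^ 2 * ℓ := by
              gcongr; nlinarith [sq_nonneg |M|]
            have h7 : 2 * |M| * κ i ≤ κ i * κ i := by gcongr; linarith
            nlinarith
    · refine hX.tendsto_impliedVol_of_many_jumps hκ ht
        (htT.eventually (ge_mem_nhds (lt_add_one T))) hκtop fun M => ?_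
      filter_upwards [htT.eventually (lt_mem_nhds (half_lt_self hT)),
        htT.eventually (gt_mem_nhds (lt_add_one T)), hκtop.eventually_ge_atTop (T + 1),
        hκtop.eventually_ge_atTop (|M| * (2 / T))] with i h1 h2 h3 h4
      have hti := ht i
      have hκi := hκ i
      have hL0 : 0 ≤ Real.log (κ i / t i) :=
        Real.log_nonneg ((one_le_div hti).2 (by linarith))
      have hL : Real.log (κ i / t i) ≤ 2 / T * κ i := by
        refine (Real.log_le_self (by positivity)).trans ?_
        calc κ i / t i ≤ κ i / (T / 2) := by gcongr
          _ = _ := by field_simp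
      calc M * Real.log (κ i / t i) ≤ |M| * (2 / T * κ i) :=
            mul_le_mul (le_abs_self M) hL hL0 (abs_nonneg M)
        _ = |M| * (2 / T) * κ i := by ring
        _ ≤ κ i * κ i := by gcongr
        _ = κ i ^ 2 := by ring
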